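/- Let $X$ be a set and let $\mathcal S\subset[0,+\infty)^X$ be a positive Stonean vector lattice of functions, i.e. for all $f,g\in\mathcal S$ and all constants $d\ge 0$ the functions $f+g$, $f\vee g$, $f\wedge g$, $(f-g)\vee 0$ and $f\wedge d$ belong to $\mathcal S$. Let $\tilde\mu:\mathcal S\to\mathbb R$ be a Daniell functional (if $f,f_n\in\mathcal S$ $(n\in\mathbb N)$ and $f=\sum_n f_n$ pointwise, then $\tilde\mu(f)=\sum_n\tilde\mu(f_n)$) of locally bounded variation (for each $f\in\mathcal S$ the set $\{\tilde\mu(g): g\in\mathcal S,\ 0\le g\le f\}$ is bounded). Then the family $$\mathfrak I(\mathcal S)=\bigl\{\{f>1\}\setminus\{g>1\} : f,g\in\mathcal S\bigr\}$$ is an interval system, i.e. for $A,B\in\mathfrak I(\mathcal S)$ both $A\setminus B$ and $A\cap B$ are countable disjoint unions of members of $\mathfrak I(\mathcal S)$; and there is a unique measure $\mu$ on it such that $$\tilde\mu(f)=\int f\,d\mu\qquad\text{for all } f\in\mathcal S .$$ Moreover, $\mu$ is of locally finite semivariation: for each $A\in\mathfrak I(\mathcal S)$ the sums $\sum_{j\in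 J}\mu(A_j)$ over finite families of pairwise disjoint sets $A_j\in\mathfrak I(\mathcal S)$, $A_j\subset A$, are bounded. Here a measure is a function $\mu:\mathfrak I(\mathcal S)\to\mathbb R$ with $\mu(A)=\sum_{\lambda}\mu(A_\lambda)$ for every countable (possibly finite or empty) disjoint decomposition $A=\bigcup_\lambda A_\lambda$ in $\mathfrak I(\mathcal S)$. With $t^\pm=\max(\pm t,0)$, its variations $|\mu|^{\pm}(A)\in[0,+\infty]$ are the suprema of $\sum_\lambda \mu(A_\lambda)^{\pm}$ over all such decompositions of $A$. The integral is the Lebesgue-Riesz integral: for $f:X\to\mathbb R$ and $a\in\mathbb R$, $\int f\,d\mu=a$ means that there is a countable family $(c_\lambda,C_\lambda)_{\lambda\in\Lambda}$ in $\mathbb R\times\mathfrak I(\mathcal S)$ such that at every $x\in X$ either $\sum_{x\in C_\lambda}c_\lambda^+=\sum_{x\in C_\lambda}c_\lambda^-=+\infty$, or both sums are finite and their difference is $f(x)$; and such that the sums $\sum_\lambda\bigl(c_\lambda^+|\mu|^+(C_\lambda)+c_\lambda^-|\mu|^-(C_\lambda)\bigr)$ and $\sum_\lambda\bigl(c_\lambda^-|\mu|^+(C_\lambda)+c_\lambda^+|\mu|^-(C_\lambda)\bigr)$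 are finite with difference $a$ (with $0\cdot\infty=0$). -/

import Mathlib

open scoped ENNReal

namespace LebesgueRiesz

/-- A positive vector lattice of functions: a subset of `[0,∞)^X` that is closed under
`f + g`, `f ∨ g`, `f ∧ g` and `(f - g) ∨ 0`. -/
structure IsPositiveVectorLattice {X : Type*} (S : Set (X → ℝ)) : Prop where
  nonneg : ∀ f ∈ S, ∀ x, 0 ≤ f x
  add_mem : ∀ f ∈ S, ∀ g ∈ S, f + g ∈ S
  sup_mem : ∀ f ∈ S, ∀ g ∈ S, f ⊔ g ∈ S
  inf_mem : ∀ f ∈ S, ∀ g ∈ S, f ⊓ g ∈ S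
  sub_sup_zero_mem : ∀ f ∈ S, ∀ g ∈ S, (f - g) ⊔ 0 ∈ S

/-- The Stonean property: `f ∧ d ∈ S` for every `f ∈ S` and every constant `d ≥ 0`. -/
def IsStonean {X : Type*} (S : Set (X → ℝ)) : Prop :=
  ∀ f ∈ S, ∀ d : ℝ, 0 ≤ d → f ⊓ (fun _ => d) ∈ S

/-- Daniell functionals: `f = ∑ fₙ` pointwise, with `f` and all `fₙ` in `S`,
implies `m f = ∑ m fₙ`. -/
def IsDaniell {X : Type*} {S : Set (X → ℝ)} (m : S → ℝ) : Prop :=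
  ∀ (f : ℕ → S) (g : S),
    (∀ x, HasSum (fun n => (f n : X → ℝ) x) ((g : X → ℝ) x)) →
      HasSum (fun n => m (f n)) (m g)

/-- Locally bounded variation: `{m g : g ∈ S, 0 ≤ g ≤ f}` is bounded for every `f ∈ S`. -/
def IsLocallyBoundedVariation {X : Type*} {S : Set (X → ℝ)} (m : S → ℝ) : Prop :=
  ∀ f : S, Bornology.IsBounded
    {r : ℝ | ∃ g : S, (0 : X → ℝ) ≤ (g : X → ℝ) ∧ (g : X → ℝ) ≤ (f : X → ℝ) ∧ m g = r}

/-- The sets `{f > 1} \ {g > 1}` with `f, g ∈ S`. -/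
def levelSystem {X : Type*} (S : Set (X → ℝ)) : Set (Set X) :=
  {A | ∃ f ∈ S, ∃ g ∈ S, A = {x | 1 < f x} \ {x | 1 < g x}}

/-- Interval systems: for `A, B ∈ 𝔖` the sets `A \ B` and `A ∩ B` are unions of countable families
of pairwise disjoint members of `𝔖`. -/
def IsIntervalSystem {X : Type*} (𝔖 : Set (Set X)) : Prop :=
  ∀ A ∈ 𝔖, ∀ B ∈ 𝔖,
    (∃ 𝔠 ⊆ 𝔖, 𝔠.Countable ∧ 𝔠.PairwiseDisjoint id ∧ A \ B = ⋃₀ 𝔠) ∧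
    (∃ 𝔡 ⊆ 𝔖, 𝔡.Countable ∧ 𝔡.PairwiseDisjoint id ∧ A ∩ B = ⋃₀ 𝔡)

/-- The indexed family `B` of members of `𝔖` is a disjoint decomposition of the set `A`. -/
def IsDecomposition {X : Type*} {𝔖 : Set (Set X)} {Λ : Type} (A : Set X) (B : Λ → 𝔖) : Prop :=
  (∀ i j, i ≠ j → Disjoint (B i : Set X) (B j : Set X)) ∧ ⋃ i, (B i : Set X) = A

/-- Real measures on a set system: `σ`-additivity for all countable (possibly finite or empty)
disjoint decompositions within `𝔖`. -/
def IsMeasure {X : Type*} {𝔖 : Set (Set X)} (μ : 𝔖 → ℝ) : Prop :=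
  ∀ (Λ : Type) [Countable Λ] (A : 𝔖) (B : Λ → 𝔖),
    IsDecomposition (A : Set X) B → HasSum (fun i => μ (B i)) (μ A)

/-- The semivariation of `A`: the closure of the set of all sums `∑ μ (A_j)` over finite families
of pairwise disjoint `A_j ∈ 𝔖` contained in `A`. -/
def semivariation {X : Type*} {𝔖 : Set (Set X)} (μ : 𝔖 → ℝ) (A : 𝔖) : Set ℝ :=
  closure {r : ℝ | ∃ (J : Type) (_ : Fintype J) (B : J → 𝔖),
    (∀ i j, i ≠ j → Disjoint (B i : Set X) (B j : Set X)) ∧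
    (∀ j, (B j : Set X) ⊆ (A : Set X)) ∧ r = ∑ j, μ (B j)}

/-- Locally finite semivariation of a real measure: every semivariation is bounded. -/
def IsLocallyFiniteSemivariation {X : Type*} {𝔖 : Set (Set X)} (μ : 𝔖 → ℝ) : Prop :=
  ∀ A : 𝔖, Bornology.IsBounded (semivariation μ A)

/-- The positive variation `|μ|⁺(A)`: the supremum of `∑ (μ (A_i))⁺` over all countable disjoint
decompositions of `A` in `𝔖`. -/
noncomputable def posVar {X : Type*} {𝔖 : Set (Set X)} (μ : 𝔖 → ℝ) (A : 𝔖) : ℝ≥0∞ :=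
  sSup {v : ℝ≥0∞ | ∃ (Λ : Type) (_ : Countable Λ) (B : Λ → 𝔖),
    IsDecomposition (A : Set X) B ∧ v = ∑' i, ENNReal.ofReal (μ (B i))}

/-- The negative variation `|μ|⁻(A)`: the supremum of `∑ (μ (A_i))⁻` over all countable disjoint
decompositions of `A` in `𝔖`. -/
noncomputable def negVar {X : Type*} {𝔖 : Set (Set X)} (μ : 𝔖 → ℝ) (A : 𝔖) : ℝ≥0∞ :=
  sSup {v : ℝ≥0∞ | ∃ (Λ : Type) (_ : Countable Λ) (B : Λ → 𝔖),
    IsDecomposition (A : Set X) B ∧ v = ∑' i, ENNReal.ofReal (-μ (B i))}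

/-- A formal sum over `𝔖`: a countable indexed family of pairs from `ℝ × 𝔖`. -/
structure FormalSum {X : Type*} (𝔖 : Set (Set X)) where
  Index : Type
  countable_index : Countable Index
  coeff : Index → ℝ
  coeffSet : Index → 𝔖

namespace FormalSum

variable {X : Type*} {𝔖 : Set (Set X)}

/-- The sum of the positive parts of the coefficients whose sets contain `x`. -/
noncomputable def posValue (C : FormalSum 𝔖) (x : X) : ℝ≥0∞ :=
  ∑' i, (C.coeffSet i : Set X).indicator (fun _ => ENNReal.ofReal (C.coeff i)) x

/-- The sum of the negative parts of the coefficients whose sets contain `x`. -/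
noncomputable def negValue (C : FormalSum 𝔖) (x : X) : ℝ≥0∞ :=
  ∑' i, (C.coeffSet i : Set X).indicator (fun _ => ENNReal.ofReal (-C.coeff i)) x

/-- The positive variation `∑ (cᵢ⁺ |μ|⁺(Cᵢ) + cᵢ⁻ |μ|⁻(Cᵢ))` of a formal sum. -/
noncomputable def posIntegral (μ : 𝔖 → ℝ) (C : FormalSum 𝔖) : ℝ≥0∞ :=
  ∑' i, (ENNReal.ofReal (C.coeff i) * posVar μ (C.coeffSet i) +
    ENNReal.ofReal (-C.coeff i) * negVar μ (C.coeffSet i))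

/-- The negative variation `∑ (cᵢ⁻ |μ|⁺(Cᵢ) + cᵢ⁺ |μ|⁻(Cᵢ))` of a formal sum. -/
noncomputable def negIntegral (μ : 𝔖 → ℝ) (C : FormalSum 𝔖) : ℝ≥0∞ :=
  ∑' i, (ENNReal.ofReal (-C.coeff i) * posVar μ (C.coeffSet i) +
    ENNReal.ofReal (C.coeff i) * negVar μ (C.coeffSet i))

end FormalSum

/-- The extended difference `p - n` of `p, n ∈ [0,∞]` is the real number `a`. -/
def IsFiniteDiff (p n : ℝ≥0∞) (a : ℝ) : Prop :=
  p ≠ ∞ ∧ n ≠ ∞ ∧ p.toReal - n.toReal = a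

/-- The Lebesgue-Riesz integral of the real function `f` exists and is the real number `a`:
there is a formal sum whose value is `f x` at every point `x` at which it is not of the
indefinite form `∞ - ∞`, and whose overall sum (positive minus negative variation) is `a`. -/
def HasIntegral {X : Type*} {𝔖 : Set (Set X)} (μ : 𝔖 → ℝ) (f : X → ℝ) (a : ℝ) : Prop :=
  ∃ C : FormalSum 𝔖,
    (∀ x, (C.posValue x = ∞ ∧ C.negValue x = ∞) ∨
      IsFiniteDiff (C.posValue x) (C.negValue x) (f x)) ∧
    IsFiniteDiff (C.posIntegral μ) (C.negIntegral μ) a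

end LebesgueRiesz

/-! Existence. As for signed measures, `m` is split into two positive functionals: `posPart m f` is
the supremum of `m g` over `g ≤ f` in `S`, and the same is done for `-m`. Countable Riesz
decomposition (`exists_decomposition`) turns the Daniell property into countable subadditivity of
these parts, bounded variation makes them finite, and their difference is `m`.

Each positive part `p` induces an outer measure by countable covers with functions of `S`. The ramps
`k (h - h ∧ 1)` vanish off `{h > 1}` and grow without bound on it, so cutting a cover with them
shows that `{h > 1}` is Carathéodory measurable. The resulting measure represents `p`
(`lintegral_eq`): the integer step function below `g` differs from `g` by at most one, its integral
lies between `p (g - g ∧ 1)` and `p g`, and rescaling `g = n f` makes the error vanish.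

With `P` and `Q` representing the two parts, put `μ = P - Q` on the level sets, where both are
finite. The variations of `μ` may be smaller than `P` and `Q`, but by the same amount
(`posVar_add_eq_negVar_add`), so integrals are unaffected. The binary expansion of `f` is a formal
sum with nonnegative coefficients, hence free of `∞ - ∞`, and it witnesses the integral.

Uniqueness. For any representing measure `ν`, both variations are countably additive on the semiring
of level sets and extend to measures `N`, `N'`, for which every member of `S` is integrable.
Dominated convergence along `ramp h k ∧ 1` then gives `ν {h > 1}` as a limit of values of `m`.
Additivity extends this to differences of level sets. -/

namespace LebesgueRiesz

open Filter Topology MeasureTheory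

/-! ### Riesz decomposition and the Jordan decomposition of the functional -/

section PositiveFunctionals

variable {X : Type*} {S : Set (X → ℝ)}

lemma ofReal_le_tsum_ofReal {ι : Type*} {f : ι → ℝ} {a : ℝ} (h : HasSum f a) :
    ENNReal.ofReal a ≤ ∑' i, ENNReal.ofReal (f i) := by
  refine le_of_tendsto_of_tendsto' ((ENNReal.continuous_ofReal.tendsto a).comp h)
    ENNReal.summable.hasSum fun s => ?_
  exact Finset.le_sum_of_subadditive _ ENNReal.ofReal_zero.le (fun _ _ => ENNReal.ofReal_add_le) s f

namespace IsPositiveVectorLattice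

lemma zero_mem (hS : IsPositiveVectorLattice S) (hne : S.Nonempty) : (0 : X → ℝ) ∈ S := by
  obtain ⟨f, hf⟩ := hne
  simpa using hS.sub_sup_zero_mem f hf f hf

lemma sub_mem (hS : IsPositiveVectorLattice S) {f g : X → ℝ} (hf : f ∈ S) (hg : g ∈ S)
    (hgf : g ≤ f) : f - g ∈ S := by
  have h := hS.sub_sup_zero_mem f hf g hg
  rwa [sup_eq_left.2 (sub_nonneg.2 hgf)] at h

lemma sum_mem (hS : IsPositiveVectorLattice S) (hne : S.Nonempty) {f : ℕ → X → ℝ}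
    (hf : ∀ n, f n ∈ S) (n : ℕ) : ∑ i ∈ Finset.range n, f i ∈ S := by
  induction n with
  | zero => simpa using hS.zero_mem hne
  | succ n ih => rw [Finset.sum_range_succ]; exact hS.add_mem _ ih _ (hf n)

lemma nsmul_mem (hS : IsPositiveVectorLattice S) {f : X → ℝ} (hf : f ∈ S) (n : ℕ) :
    n • f ∈ S := by
  simpa using hS.sum_mem ⟨f, hf⟩ (fun _ => hf) n

/-- Countable Riesz decomposition. -/
lemma exists_decomposition (hS : IsPositiveVectorLattice S) {g : X → ℝ} (hg : g ∈ S)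
    {f : ℕ → X → ℝ} (hf : ∀ n, f n ∈ S)
    (hgf : ∀ x, ENNReal.ofReal (g x) ≤ ∑' n, ENNReal.ofReal (f n x)) :
    ∃ u : ℕ → X → ℝ, (∀ n, u n ∈ S) ∧ (∀ n, u n ≤ f n) ∧
      ∀ x, HasSum (fun n => u n x) (g x) := by
  -- The pieces are the increments of `g ∧ s n`. Each is at most `f n`, and they telescope to `g`
  -- because the partial sums `s n` approach or exceed `g` pointwise; the full sum of the `f n` may
  -- diverge.
  set s : ℕ → X → ℝ := fun n => ∑ i ∈ Finset.range n, f i with hs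
  have hsS : ∀ n, s n ∈ S := hS.sum_mem ⟨g, hg⟩ hf
  have hsucc : ∀ n, s (n + 1) = s n + f n := fun n => Finset.sum_range_succ _ _
  have hmono : ∀ n, g ⊓ s n ≤ g ⊓ s (n + 1) := fun n => by
    refine inf_le_inf_left _ ?_
    rw [hsucc]
    exact le_add_of_nonneg_right (hS.nonneg _ (hf n))
  have hS' : ∀ n, g ⊓ s (n + 1) - g ⊓ s n ∈ S := fun n =>
    hS.sub_mem (hS.inf_mem _ hg _ (hsS _)) (hS.inf_mem _ hg _ (hsS _)) (hmono n)
  refine ⟨fun n => g ⊓ s (n + 1) - g ⊓ s n, hS', fun n x => ?_, fun x => ?_⟩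
  · have h0 := hS.nonneg _ (hf n) x
    simp only [hsucc, Pi.sub_apply, Pi.inf_apply, Pi.add_apply]
    rcases le_total (g x) (s n x) with h | h
    · simp [h, le_add_of_le_of_nonneg h h0, h0]
    · rw [inf_eq_right.2 h]
      linarith [min_le_right (g x) (s n x + f n x)]
  · rw [hasSum_iff_tendsto_nat_of_nonneg (fun n => hS.nonneg _ (hS' n) x)]
    have hpart : ∀ n, ∑ i ∈ Finset.range n, (g ⊓ s (i + 1) - g ⊓ s i) x = min (g x) (s n x) := by
      intro n
      have h := Finset.sum_range_sub (fun i => min (g x) (s i x)) n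
      have h0 : min (g x) (s 0 x) = 0 := by simp [hs, hS.nonneg g hg x]
      simpa [h0] using h
    simp only [hpart]
    have hof : ∀ n, ENNReal.ofReal (min (g x) (s n x))
        = min (ENNReal.ofReal (g x)) (∑ i ∈ Finset.range n, ENNReal.ofReal (f i x)) := by
      intro n
      rw [← ENNReal.ofReal_sum_of_nonneg (fun i _ => hS.nonneg _ (hf i) x)]
      rw [(ENNReal.ofReal_mono).map_min]
      simp [hs]
    have hlim : Tendsto (fun n => ENNReal.ofReal (min (g x) (s n x))) atTop
        (𝓝 (ENNReal.ofReal (g x))) := by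
      simp only [hof]
      conv => rhs; rw [← min_eq_left (hgf x)]
      exact tendsto_const_nhds.min (ENNReal.tendsto_nat_tsum _)
    have h := (ENNReal.tendsto_toReal ENNReal.ofReal_ne_top).comp hlim
    rw [ENNReal.toReal_ofReal (hS.nonneg g hg x)] at h
    refine h.congr fun n => ?_
    exact ENNReal.toReal_ofReal (le_min (hS.nonneg g hg x) (hS.nonneg _ (hsS n) x))

end IsPositiveVectorLattice

/-- Positive, finite, additive and countably subadditive functionals on a lattice of functions. -/
structure IsPositiveDaniell (S : Set (X → ℝ)) (p : (X → ℝ) → ℝ≥0∞) : Prop where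
  ne_top : ∀ f ∈ S, p f ≠ ∞
  add : ∀ f ∈ S, ∀ g ∈ S, p (f + g) = p f + p g
  le_tsum : ∀ g ∈ S, ∀ f : ℕ → X → ℝ, (∀ n, f n ∈ S) →
    (∀ x, ENNReal.ofReal (g x) ≤ ∑' n, ENNReal.ofReal (f n x)) → p g ≤ ∑' n, p (f n)

namespace IsDaniell

variable {m : S → ℝ}

/-- Since `0 = 0 + 0 + ⋯`, a constant series with terms `m z` converges, which forces its terms to
vanish. -/
lemma map_zero (hm : IsDaniell m) (z : S) (hz : (z : X → ℝ) = 0) : m z = 0 := by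
  have h := hm (fun _ => z) z (fun x => by simp [hz])
  exact tendsto_nhds_unique tendsto_const_nhds h.summable.tendsto_atTop_zero

lemma map_add (hm : IsDaniell m) (hS : IsPositiveVectorLattice S) (f g h : S)
    (hfg : (h : X → ℝ) = f + g) : m h = m f + m g := by
  set z : S := ⟨0, hS.zero_mem ⟨f, f.2⟩⟩
  have hz : m z = 0 := hm.map_zero z rfl
  set u : ℕ → S := fun n => if n = 0 then f else if n = 1 then g else z with hu
  have hu' : ∀ n ∉ Finset.range 2, u n = z := by
    intro n hn
    simp only [Finset.mem_range, not_lt] at hn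
    simp [hu, show n ≠ 0 by omega, show n ≠ 1 by omega]
  have h1 := hm u h (fun x => by
    have h2 := hasSum_sum_of_ne_finset_zero (L := .unconditional ℕ)
      (f := fun n => (u n : X → ℝ) x) (s := Finset.range 2) (fun n hn => by rw [hu' n hn]; rfl)
    simpa [Finset.sum_range_succ, hu, hfg] using h2)
  have h2 := hasSum_sum_of_ne_finset_zero (L := .unconditional ℕ) (f := fun n => m (u n))
      (s := Finset.range 2) (fun n hn => by rw [hu' n hn]; exact hz)
  have h3 := h1.unique h2
  simpa [Finset.sum_range_succ, hu] using h3

lemma neg (hm : IsDaniell m) : IsDaniell (fun f => -m f) := fun f g h => (hm f g h).neg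

end IsDaniell

lemma IsLocallyBoundedVariation.neg {m : S → ℝ} (hm : IsLocallyBoundedVariation m) :
    IsLocallyBoundedVariation (fun f => -m f) := fun f => by
  refine ((hm f).neg).subset ?_
  rintro r ⟨g, h0, h1, rfl⟩
  exact ⟨g, h0, h1, by simp⟩

/-- The positive part of a functional of locally bounded variation. -/
noncomputable def posPart (m : S → ℝ) (f : X → ℝ) : ℝ≥0∞ :=
  ⨆ (g : S) (_ : (g : X → ℝ) ≤ f), ENNReal.ofReal (m g)

lemma le_posPart (m : S → ℝ) {f : X → ℝ} (g : S) (hg : (g : X → ℝ) ≤ f) :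
    ENNReal.ofReal (m g) ≤ posPart m f :=
  le_iSup₂_of_le g hg le_rfl

/-- Any competitor `h ≤ g` splits into pieces `u n ≤ f n` in `S`. The pieces are competitors for the
`f n`, and `m h` is the sum of their values. -/
lemma posPart_le_tsum {m : S → ℝ} (hS : IsPositiveVectorLattice S) (hm : IsDaniell m)
    {g : X → ℝ} {f : ℕ → X → ℝ} (hf : ∀ n, f n ∈ S)
    (hgf : ∀ x, ENNReal.ofReal (g x) ≤ ∑' n, ENNReal.ofReal (f n x)) :
    posPart m g ≤ ∑' n, posPart m (f n) := by
  refine iSup₂_le fun h hh => ?_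
  obtain ⟨u, huS, huf, hu⟩ := hS.exists_decomposition h.2 hf
    (fun x => (ENNReal.ofReal_le_ofReal (hh x)).trans (hgf x))
  have hsum := hm (fun n => ⟨u n, huS n⟩) h hu
  refine (ofReal_le_tsum_ofReal hsum).trans ?_
  exact ENNReal.tsum_le_tsum fun n => le_posPart m _ (huf n)

lemma posPart_add_le {m : S → ℝ} (hS : IsPositiveVectorLattice S) (hm : IsDaniell m)
    {f g : X → ℝ} (hf : f ∈ S) (hg : g ∈ S) :
    posPart m f + posPart m g ≤ posPart m (f + g) := by
  have : Nonempty S := ⟨⟨f, hf⟩⟩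
  have hf0 := hS.nonneg f hf
  have hg0 := hS.nonneg g hg
  refine ENNReal.biSup_add_biSup_le' (p := fun u : S => (u : X → ℝ) ≤ f)
    (q := fun u : S => (u : X → ℝ) ≤ g) ⟨⟨f, hf⟩, le_rfl⟩ ⟨⟨g, hg⟩, le_rfl⟩ ?_
  intro u hu v hv
  -- `ENNReal.ofReal` discards negative values, so a competitor with `m ≤ 0` contributes nothing and
  -- the other one alone suffices.
  rcases le_total (m u) 0 with h | h
  · rw [ENNReal.ofReal_of_nonpos h, zero_add]
    exact le_posPart m v (hv.trans (le_add_of_nonneg_left hf0))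
  rcases le_total (m v) 0 with h' | h'
  · rw [ENNReal.ofReal_of_nonpos h', add_zero]
    exact le_posPart m u (hu.trans (le_add_of_nonneg_right hg0))
  rw [← ENNReal.ofReal_add h h', ← hm.map_add hS u v ⟨u + v, hS.add_mem _ u.2 _ v.2⟩ rfl]
  exact le_posPart m _ (add_le_add hu hv)

lemma isPositiveDaniell_posPart {m : S → ℝ} (hS : IsPositiveVectorLattice S) (hm : IsDaniell m)
    (hbv : IsLocallyBoundedVariation m) : IsPositiveDaniell S (posPart m) where
  ne_top f hf := by
    obtain ⟨C, hC⟩ := (hbv ⟨f, hf⟩).exists_norm_le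
    refine ne_top_of_le_ne_top (ENNReal.ofReal_ne_top (r := C)) (iSup₂_le fun g hg => ?_)
    refine ENNReal.ofReal_le_ofReal ((le_abs_self _).trans (hC _ ⟨g, hS.nonneg g g.2, hg, rfl⟩))
  add f hf g hg := by
    refine le_antisymm ?_ (posPart_add_le hS hm hf hg)
    set u : ℕ → X → ℝ := fun n => if n = 0 then f else if n = 1 then g else 0 with hu
    have h0 : posPart m (0 : X → ℝ) = 0 := by
      refine le_antisymm (iSup₂_le fun z hz => ?_) zero_le
      rw [hm.map_zero z (le_antisymm hz (hS.nonneg z z.2))]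
      simp
    have huS : ∀ n, u n ∈ S := fun n => by
      simp only [hu]
      split_ifs
      exacts [hf, hg, hS.zero_mem ⟨f, hf⟩]
    have hu' : ∀ n ∉ Finset.range 2, u n = 0 := by
      intro n hn
      simp only [Finset.mem_range, not_lt] at hn
      simp [hu, show n ≠ 0 by omega, show n ≠ 1 by omega]
    refine (posPart_le_tsum hS hm huS (g := f + g) fun x => ?_).trans_eq ?_
    · rw [tsum_eq_sum (s := Finset.range 2) (fun n hn => by rw [hu' n hn]; simp)]
      simpa [Finset.sum_range_succ, hu] using ENNReal.ofReal_add_le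
    · rw [tsum_eq_sum (s := Finset.range 2) (fun n hn => by rw [hu' n hn]; exact h0)]
      simp [Finset.sum_range_succ, hu]
  le_tsum g _ f hf h := posPart_le_tsum hS hm hf h

/-- Passing from `g` to `f - g` exchanges competitors for `m` with competitors for `-m`, because `m
g = m f - m (f - g)`. Writing this with sums only avoids truncated subtraction; applying it to `-m`
as well gives equality. -/
lemma posPart_add_ofReal_neg_le {m : S → ℝ} (hS : IsPositiveVectorLattice S) (hm : IsDaniell m)
    (f : S) : posPart m f + ENNReal.ofReal (-m f)
      ≤ posPart (fun g => -m g) f + ENNReal.ofReal (m f) := by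
  rw [posPart, ENNReal.biSup_add' (p := fun g : S => (g : X → ℝ) ≤ f) ⟨f, le_rfl⟩]
  refine iSup₂_le fun g hg => ?_
  rcases le_total (m g) 0 with h | h
  · rw [ENNReal.ofReal_of_nonpos h, zero_add]
    exact le_add_of_le_left (le_posPart (fun g => -m g) f le_rfl)
  · set k : S := ⟨(f : X → ℝ) - g, hS.sub_mem f.2 g.2 hg⟩
    have hk : m f = m g + m k := hm.map_add hS g k f (by simp [k])
    have h1 := le_posPart (fun g => -m g) (f := f) k
      (sub_le_self _ (hS.nonneg g g.2))
    refine le_trans ?_ (add_le_add_left h1 _)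
    rcases le_total (m f) 0 with h2 | h2
    · rw [ENNReal.ofReal_of_nonpos h2, ← ENNReal.ofReal_add h (by linarith), add_zero]
      exact ENNReal.ofReal_le_ofReal (by linarith)
    · rw [ENNReal.ofReal_of_nonpos (by linarith : -m f ≤ 0), add_zero]
      refine le_trans (ENNReal.ofReal_le_ofReal ?_) ENNReal.ofReal_add_le
      linarith

/-- Jordan decomposition of a Daniell functional of locally bounded variation. -/
lemma toReal_posPart_sub_toReal_posPart_neg {m : S → ℝ} (hS : IsPositiveVectorLattice S)
    (hm : IsDaniell m) (hbv : IsLocallyBoundedVariation m) (f : S) :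
    (posPart m f).toReal - (posPart (fun g => -m g) f).toReal = m f := by
  have h1 := posPart_add_ofReal_neg_le hS hm f
  have h2 := posPart_add_ofReal_neg_le hS hm.neg f
  simp only [neg_neg] at h2
  have hp := (isPositiveDaniell_posPart hS hm hbv).ne_top f f.2
  have hq := (isPositiveDaniell_posPart hS hm.neg hbv.neg).ne_top f f.2
  have h := congrArg ENNReal.toReal (le_antisymm h1 h2)
  rw [ENNReal.toReal_add hp ENNReal.ofReal_ne_top, ENNReal.toReal_add hq ENNReal.ofReal_ne_top,
    ENNReal.toReal_ofReal', ENNReal.toReal_ofReal'] at h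
  rcases le_total (m f) 0 with h3 | h3
  · rw [max_eq_left (by linarith), max_eq_right h3] at h; linarith
  · rw [max_eq_right (by linarith), max_eq_left h3] at h; linarith

end PositiveFunctionals

/-! ### Level sets, ramps and integer step functions -/

section LevelSets

variable {X : Type*} {S : Set (X → ℝ)}

lemma diff_mem_levelSystem {f g : X → ℝ} (hf : f ∈ S) (hg : g ∈ S) :
    {x | 1 < f x} \ {x | 1 < g x} ∈ levelSystem S := ⟨f, hf, g, hg, rfl⟩

lemma setOf_one_lt_mem_levelSystem (hS : IsPositiveVectorLattice S) {f : X → ℝ} (hf : f ∈ S) :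
    {x | 1 < f x} ∈ levelSystem S :=
  ⟨f, hf, 0, hS.zero_mem ⟨f, hf⟩, by ext; simp [not_lt.2 zero_le_one]⟩

lemma inter_mem_levelSystem (hS : IsPositiveVectorLattice S) {A B : Set X}
    (hA : A ∈ levelSystem S) (hB : B ∈ levelSystem S) : A ∩ B ∈ levelSystem S := by
  obtain ⟨f, hf, g, hg, rfl⟩ := hA
  obtain ⟨f', hf', g', hg', rfl⟩ := hB
  refine ⟨f ⊓ f', hS.inf_mem _ hf _ hf', g ⊔ g', hS.sup_mem _ hg _ hg', ?_⟩
  ext x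
  simp only [Set.mem_inter_iff, Set.mem_sdiff, Set.mem_ofPred_eq, Pi.inf_apply, Pi.sup_apply,
    lt_inf_iff, lt_sup_iff]
  tauto

/-- A point of `A` is outside `B` either because `f' > 1` fails, or because `f' > 1` and `g' > 1`
both hold; the two cases exclude each other. -/
lemma exists_diff_eq_union_of_mem_levelSystem (hS : IsPositiveVectorLattice S) {A B : Set X}
    (hA : A ∈ levelSystem S) (hB : B ∈ levelSystem S) :
    ∃ C ∈ levelSystem S, ∃ D ∈ levelSystem S, Disjoint C D ∧ A \ B = C ∪ D := by
  obtain ⟨f, hf, g, hg, rfl⟩ := hA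
  obtain ⟨f', hf', g', hg', rfl⟩ := hB
  refine ⟨_, diff_mem_levelSystem hf (hS.sup_mem _ hg _ hf'), _,
    diff_mem_levelSystem (hS.inf_mem _ hf _ (hS.inf_mem _ hf' _ hg')) hg, ?_, ?_⟩
  · rw [Set.disjoint_left]
    intro x
    simp only [Set.mem_sdiff, Set.mem_ofPred_eq, Pi.inf_apply, Pi.sup_apply, lt_inf_iff, lt_sup_iff]
    tauto
  · ext x
    simp only [Set.mem_union, Set.mem_sdiff, Set.mem_ofPred_eq, Pi.inf_apply, Pi.sup_apply,
      lt_inf_iff, lt_sup_iff]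
    tauto

lemma pairwiseDisjoint_pair {C D : Set X} (h : Disjoint C D) :
    ({C, D} : Set (Set X)).PairwiseDisjoint id := by
  rintro s (rfl | rfl) t (rfl | rfl) hst
  exacts [(hst rfl).elim, h, h.symm, (hst rfl).elim]

lemma isIntervalSystem_levelSystem (hS : IsPositiveVectorLattice S) :
    IsIntervalSystem (levelSystem S) := by
  intro A hA B hB
  constructor
  · obtain ⟨C, hC, D, hD, hCD, h⟩ := exists_diff_eq_union_of_mem_levelSystem hS hA hB
    exact ⟨{C, D}, by simp [Set.insert_subset_iff, hC, hD], Set.to_countable _,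
      pairwiseDisjoint_pair hCD, by simpa using h⟩
  · exact ⟨{A ∩ B}, by simpa using inter_mem_levelSystem hS hA hB, Set.to_countable _,
      Set.pairwiseDisjoint_singleton _ _, by simp⟩

lemma isSetSemiring_levelSystem (hS : IsPositiveVectorLattice S) (hne : S.Nonempty) :
    IsSetSemiring (levelSystem S) where
  empty_mem := by
    obtain ⟨f, hf⟩ := hne
    exact ⟨f, hf, f, hf, by simp⟩
  inter_mem A hA B hB := inter_mem_levelSystem hS hA hB
  sdiff_eq_sUnion' A hA B hB := by
    classical
    obtain ⟨C, hC, D, hD, hCD, h⟩ := exists_diff_eq_union_of_mem_levelSystem hS hA hB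
    exact ⟨{C, D}, by simp [Set.insert_subset_iff, hC, hD],
      by simpa using pairwiseDisjoint_pair hCD, by simpa using h⟩

/-- Superlevel sets at positive heights are superlevel sets at height one. -/
lemma exists_setOf_one_lt_eq (hS : IsPositiveVectorLattice S) (hStone : IsStonean S)
    {f : X → ℝ} (hf : f ∈ S) {c : ℝ} (hc : 0 < c) :
    ∃ h ∈ S, {x | 1 < h x} = {x | c < f x} := by
  -- The witness is the positive part of `n f - n c + 1`, which exceeds `1` exactly where `f > c`.
  -- The choice of `n` makes `n c - 1` nonnegative, as the Stonean property demands, and an integer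
  -- multiple stays in `S` by additivity.
  obtain ⟨n, hn⟩ := exists_nat_ge (1 / c)
  have hnc : 1 ≤ n * c := by rwa [div_le_iff₀ hc] at hn
  have hn0 : (0 : ℝ) < n := lt_of_lt_of_le (by positivity) hn
  have hnf := hS.nsmul_mem hf n
  refine ⟨n • f - (n • f) ⊓ (fun _ => n * c - 1),
    hS.sub_mem hnf (hStone _ hnf _ (by linarith)) inf_le_left, ?_⟩
  ext x
  simp only [Set.mem_ofPred_eq, Pi.sub_apply, Pi.inf_apply, Pi.smul_apply]
  simp only [nsmul_eq_mul]
  rcases le_total (n * f x) (n * c - 1) with h | h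
  · rw [inf_eq_left.2 h]
    refine ⟨fun h' => by linarith, fun h' => ?_⟩
    have := mul_lt_mul_of_pos_left h' hn0
    linarith
  · rw [inf_eq_right.2 h]
    refine ⟨fun h' => ?_, fun h' => ?_⟩
    · exact lt_of_mul_lt_mul_left (a := (n : ℝ)) (by linarith) hn0.le
    · have := mul_lt_mul_of_pos_left h' hn0
      linarith

lemma setOf_lt_mem_levelSystem (hS : IsPositiveVectorLattice S) (hStone : IsStonean S)
    {f : X → ℝ} (hf : f ∈ S) {c : ℝ} (hc : 0 < c) : {x | c < f x} ∈ levelSystem S := by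
  obtain ⟨h, hh, he⟩ := exists_setOf_one_lt_eq hS hStone hf hc
  exact he ▸ setOf_one_lt_mem_levelSystem hS hh

lemma setOf_lt_diff_mem_levelSystem (hS : IsPositiveVectorLattice S) (hStone : IsStonean S)
    {f : X → ℝ} (hf : f ∈ S) {c d : ℝ} (hc : 0 < c) (hd : 0 < d) :
    {x | c < f x} \ {x | d < f x} ∈ levelSystem S := by
  obtain ⟨h, hh, he⟩ := exists_setOf_one_lt_eq hS hStone hf hc
  obtain ⟨k, hk, hke⟩ := exists_setOf_one_lt_eq hS hStone hf hd
  exact he ▸ hke ▸ diff_mem_levelSystem hh hk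

lemma measurable_of_mem [mX : MeasurableSpace X]
    (hmX : mX = MeasurableSpace.generateFrom (levelSystem S)) (hS : IsPositiveVectorLattice S)
    (hStone : IsStonean S) {f : X → ℝ} (hf : f ∈ S) : Measurable f := by
  have hpos : ∀ c : ℝ, 0 < c → MeasurableSet {x | c < f x} := fun c hc => by
    rw [hmX]
    exact MeasurableSpace.measurableSet_generateFrom (setOf_lt_mem_levelSystem hS hStone hf hc)
  refine measurable_of_Ioi fun c => ?_
  rcases lt_trichotomy c 0 with hc | rfl | hc
  · convert MeasurableSet.univ
    exact Set.eq_univ_of_forall fun x => hc.trans_le (hS.nonneg f hf x)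
  · have : f ⁻¹' Set.Ioi 0 = ⋃ n : ℕ, {x | 1 / ((n : ℝ) + 1) < f x} := by
      ext x
      simp only [Set.mem_preimage, Set.mem_Ioi, Set.mem_iUnion, Set.mem_ofPred_eq]
      exact ⟨exists_nat_one_div_lt, fun ⟨n, hn⟩ => lt_trans (by positivity) hn⟩
    rw [this]
    exact MeasurableSet.iUnion fun n => hpos _ (by positivity)
  · exact hpos c hc

/-- The functions `k (h - h ∧ 1)`. -/
def ramp (h : X → ℝ) (k : ℕ) : X → ℝ := k • (h - h ⊓ fun _ => 1)

lemma ramp_apply (h : X → ℝ) (k : ℕ) (x : X) : ramp h k x = k * (h x - min (h x) 1) := by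
  simp [ramp]

lemma ramp_mem (hS : IsPositiveVectorLattice S) (hStone : IsStonean S) {h : X → ℝ} (hh : h ∈ S)
    (k : ℕ) : ramp h k ∈ S :=
  hS.nsmul_mem (hS.sub_mem hh (hStone h hh 1 zero_le_one) inf_le_left) k

lemma ramp_mono (h : X → ℝ) : Monotone (ramp h) := by
  intro k l hkl x
  rw [ramp_apply, ramp_apply]
  have : (k : ℝ) ≤ l := by exact_mod_cast hkl
  exact mul_le_mul_of_nonneg_right this (sub_nonneg.2 (min_le_left _ _))

lemma ramp_eq_zero {h : X → ℝ} {x : X} (hx : ¬ 1 < h x) (k : ℕ) : ramp h k x = 0 := by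
  rw [ramp_apply, min_eq_left (not_lt.1 hx), sub_self, mul_zero]

/-- Together with `ramp_eq_zero`, this makes the ramps a substitute in `S` for `∞ · 1_{h > 1}`: `f ∧
ramp h k` increases to `f` on `{h > 1}` and is zero elsewhere when `f ≥ 0`. -/
lemma eventually_le_ramp {h : X → ℝ} {x : X} (hx : 1 < h x) (c : ℝ) :
    ∀ᶠ k in atTop, c ≤ ramp h k x := by
  have hpos : 0 < h x - min (h x) 1 := by rw [min_eq_right hx.le]; linarith
  simp only [ramp_apply]
  exact (tendsto_natCast_atTop_atTop.atTop_mul_const hpos).eventually_ge_atTop c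

/-- The number of integers `j ≥ 1` strictly below `t`. -/
noncomputable def stepCount (t : ℝ) : ℝ≥0∞ := ∑' j : ℕ, if (j : ℝ) + 1 < t then 1 else 0

/-- For `t ≤ 0` the natural ceiling is `0`, and truncated subtraction keeps the count at `0`. -/
lemma stepCount_eq (t : ℝ) : stepCount t = ((⌈t⌉₊ - 1 : ℕ) : ℝ≥0∞) := by
  have hiff : ∀ j : ℕ, (j : ℝ) + 1 < t ↔ j ∈ Finset.range (⌈t⌉₊ - 1) := by
    intro j
    have h := Nat.lt_ceil (a := t) (n := j + 1)
    push_cast at h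
    rw [← h, Finset.mem_range]
    omega
  rw [stepCount, tsum_eq_sum (s := Finset.range (⌈t⌉₊ - 1)) fun j hj => by
    rw [if_neg (by rwa [hiff])]]
  rw [Finset.sum_congr rfl fun j hj => if_pos ((hiff j).2 hj)]
  simp

lemma ofReal_sub_one_le_stepCount (t : ℝ) : ENNReal.ofReal (t - 1) ≤ stepCount t := by
  rw [stepCount_eq, ← ENNReal.ofReal_natCast]
  refine ENNReal.ofReal_le_ofReal ?_
  have h1 := Nat.le_ceil t
  have h2 : (⌈t⌉₊ : ℝ) ≤ ((⌈t⌉₊ - 1 : ℕ) : ℝ) + 1 := by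
    have : ⌈t⌉₊ ≤ (⌈t⌉₊ - 1) + 1 := by omega
    exact_mod_cast this
  linarith

lemma stepCount_le_ofReal (t : ℝ) : stepCount t ≤ ENNReal.ofReal t := by
  rw [stepCount_eq]
  rcases Nat.eq_zero_or_pos ⌈t⌉₊ with h | h
  · simp [h]
  · rw [← ENNReal.ofReal_natCast]
    refine ENNReal.ofReal_le_ofReal ?_
    rw [Nat.cast_sub h]
    have := Nat.ceil_lt_add_one (Nat.ceil_pos.1 h).le
    push_cast
    linarith

end LevelSets

/-! ### The outer measure of a positive Daniell functional -/

section Representation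

variable {X : Type*} {S : Set (X → ℝ)} {p : (X → ℝ) → ℝ≥0∞}

/-- The differences of consecutive members of a sequence, starting with the first member. -/
def increment (u : ℕ → X → ℝ) : ℕ → X → ℝ
  | 0 => u 0
  | n + 1 => u (n + 1) - u n

lemma increment_mem (hS : IsPositiveVectorLattice S) {u : ℕ → X → ℝ} (hu : ∀ n, u n ∈ S)
    (hmono : Monotone u) (n : ℕ) : increment u n ∈ S := by
  cases n with
  | zero => exact hu 0
  | succ n => exact hS.sub_mem (hu _) (hu _) (hmono n.le_succ)

lemma tsum_ofReal_increment (hS : IsPositiveVectorLattice S) {u : ℕ → X → ℝ} (hu : ∀ n, u n ∈ S)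
    (hmono : Monotone u) (x : X) :
    ∑' n, ENNReal.ofReal (increment u n x) = ⨆ n, ENNReal.ofReal (u n x) := by
  -- The first `n + 1` increments add up to `u n`, hence the shift by one.
  rw [ENNReal.tsum_eq_iSup_nat' (tendsto_add_atTop_nat 1)]
  congr 1 with n
  induction n with
  | zero => simp [increment]
  | succ n ih =>
    have h : 0 ≤ u (n + 1) x - u n x := sub_nonneg.2 (hmono n.le_succ x)
    rw [Finset.sum_range_succ, ih]
    simp only [increment, Pi.sub_apply]
    rw [← ENNReal.ofReal_add (hS.nonneg _ (hu n) x) h]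
    congr 1
    ring

namespace IsPositiveDaniell

lemma map_sub_add (hp : IsPositiveDaniell S p) (hS : IsPositiveVectorLattice S) {f g : X → ℝ}
    (hf : f ∈ S) (hg : g ∈ S) (h : g ≤ f) : p g + p (f - g) = p f := by
  rw [← hp.add g hg _ (hS.sub_mem hf hg h), add_sub_cancel]

lemma mono (hp : IsPositiveDaniell S p) (hS : IsPositiveVectorLattice S) {f g : X → ℝ}
    (hf : f ∈ S) (hg : g ∈ S) (h : g ≤ f) : p g ≤ p f :=
  (hp.map_sub_add hS hf hg h) ▸ le_self_add

lemma map_zero (hp : IsPositiveDaniell S p) (h0 : (0 : X → ℝ) ∈ S) : p 0 = 0 := by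
  have h := hp.add 0 h0 0 h0
  rw [add_zero] at h
  have h' : p 0 + 0 = p 0 + p 0 := by rwa [add_zero]
  exact ((ENNReal.add_right_inj (hp.ne_top 0 h0)).1 h').symm

lemma map_nsmul (hp : IsPositiveDaniell S p) (hS : IsPositiveVectorLattice S) {f : X → ℝ}
    (hf : f ∈ S) (n : ℕ) : p (n • f) = n * p f := by
  induction n with
  | zero => simpa using hp.map_zero (hS.zero_mem ⟨f, hf⟩)
  | succ n ih =>
    rw [succ_nsmul, hp.add _ (hS.nsmul_mem hf n) _ hf, ih]
    push_cast
    ring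

lemma tsum_increment (hp : IsPositiveDaniell S p) (hS : IsPositiveVectorLattice S)
    {u : ℕ → X → ℝ} (hu : ∀ n, u n ∈ S) (hmono : Monotone u) :
    ∑' n, p (increment u n) = ⨆ n, p (u n) := by
  rw [ENNReal.tsum_eq_iSup_nat' (tendsto_add_atTop_nat 1)]
  congr 1 with n
  induction n with
  | zero => simp [increment]
  | succ n ih =>
    rw [Finset.sum_range_succ, ih]
    exact hp.map_sub_add hS (hu _) (hu _) (hmono n.le_succ)

/-- Monotone convergence comes from countable subadditivity applied to the increments of the
sequence. -/
lemma le_iSup (hp : IsPositiveDaniell S p) (hS : IsPositiveVectorLattice S) {g : X → ℝ}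
    (hg : g ∈ S) {u : ℕ → X → ℝ} (hu : ∀ n, u n ∈ S) (hmono : Monotone u)
    (h : ∀ x, ENNReal.ofReal (g x) ≤ ⨆ n, ENNReal.ofReal (u n x)) : p g ≤ ⨆ n, p (u n) := by
  rw [← hp.tsum_increment hS hu hmono]
  exact hp.le_tsum g hg _ (increment_mem hS hu hmono) fun x =>
    (h x).trans_eq (tsum_ofReal_increment hS hu hmono x).symm

end IsPositiveDaniell

/-- The truncations `g ∧ (n + 1)`. -/
def truncation (g : X → ℝ) (n : ℕ) : X → ℝ := g ⊓ fun _ => (n : ℝ) + 1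

lemma truncation_mem (hStone : IsStonean S) {g : X → ℝ} (hg : g ∈ S) (n : ℕ) :
    truncation g n ∈ S := hStone g hg _ (by positivity)

lemma truncation_mono (g : X → ℝ) : Monotone (truncation g) := fun k l hkl => by
  refine inf_le_inf_left _ fun x => ?_
  have : (k : ℝ) ≤ l := by exact_mod_cast hkl
  simpa using this

/-- The outer content induced by a functional: the infimum of `∑ p (f n)` over all sequences in
`S` whose sum is at least one on the set. -/
noncomputable def outerContent (S : Set (X → ℝ)) (p : (X → ℝ) → ℝ≥0∞) (E : Set X) : ℝ≥0∞ :=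
  ⨅ (f : ℕ → X → ℝ) (_ : (∀ n, f n ∈ S) ∧ ∀ x ∈ E, 1 ≤ ∑' n, ENNReal.ofReal (f n x)),
    ∑' n, p (f n)

lemma outerContent_le_tsum {E : Set X} {f : ℕ → X → ℝ} (hf : ∀ n, f n ∈ S)
    (h : ∀ x ∈ E, 1 ≤ ∑' n, ENNReal.ofReal (f n x)) : outerContent S p E ≤ ∑' n, p (f n) :=
  iInf₂_le f ⟨hf, h⟩

lemma outerContent_le_tsum_tsum {E : Set X} {f : ℕ → ℕ → X → ℝ} (hf : ∀ i n, f i n ∈ S)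
    (h : ∀ x ∈ E, 1 ≤ ∑' (i) (n), ENNReal.ofReal (f i n x)) :
    outerContent S p E ≤ ∑' (i) (n), p (f i n) := by
  have key : ∀ F : (X → ℝ) → ℝ≥0∞, ∑' k : ℕ, F (f k.unpair.1 k.unpair.2)
      = ∑' (i) (n), F (f i n) := fun F => by
    rw [← ENNReal.tsum_prod, ← Nat.pairEquiv.symm.tsum_eq]
    rfl
  rw [← key p]
  refine outerContent_le_tsum (fun k => hf _ _) fun x hx => ?_
  rw [key fun g => ENNReal.ofReal (g x)]
  exact h x hx

lemma outerContent_mono {E F : Set X} (h : E ⊆ F) : outerContent S p E ≤ outerContent S p F :=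
  le_iInf₂ fun _ hf => outerContent_le_tsum hf.1 fun x hx => hf.2 x (h hx)

lemma outerContent_iUnion_le (E : ℕ → Set X) :
    outerContent S p (⋃ i, E i) ≤ ∑' i, outerContent S p (E i) := by
  refine ENNReal.le_of_forall_pos_le_add fun ε hε hfin => ?_
  obtain ⟨δ, hδ, hδε⟩ := ENNReal.exists_pos_sum_of_countable' (ENNReal.coe_pos.2 hε).ne' ℕ
  have hex : ∀ i, ∃ f : ℕ → X → ℝ, ((∀ n, f n ∈ S) ∧
      ∀ x ∈ E i, 1 ≤ ∑' n, ENNReal.ofReal (f n x)) ∧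
      ∑' n, p (f n) < outerContent S p (E i) + δ i := fun i => by
    have := ENNReal.lt_add_right (ENNReal.ne_top_of_tsum_ne_top hfin.ne i) (hδ i).ne'
    simpa only [outerContent, iInf_lt_iff, exists_prop] using this
  choose f hf hlt using hex
  calc outerContent S p (⋃ i, E i) ≤ ∑' (i) (n), p (f i n) := by
        refine outerContent_le_tsum_tsum (fun i => (hf i).1) fun x hx => ?_
        obtain ⟨i, hi⟩ := Set.mem_iUnion.1 hx
        exact ((hf i).2 x hi).trans (ENNReal.le_tsum i)
    _ ≤ ∑' i, (outerContent S p (E i) + δ i) := ENNReal.tsum_le_tsum fun i => (hlt i).le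
    _ ≤ ∑' i, outerContent S p (E i) + ε := by
        rw [ENNReal.tsum_add]
        exact add_le_add_right hδε.le _

/-- The outer measure induced by a positive Daniell functional. -/
noncomputable def IsPositiveDaniell.outerMeasure (hp : IsPositiveDaniell S p)
    (h0 : (0 : X → ℝ) ∈ S) : OuterMeasure X where
  measureOf := outerContent S p
  empty := by
    refine le_antisymm ?_ zero_le
    refine (outerContent_le_tsum (fun _ : ℕ => h0) (by simp)).trans_eq ?_
    simp [hp.map_zero h0]
  mono := outerContent_mono
  iUnion_nat E _ := outerContent_iUnion_le E

namespace IsPositiveDaniell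

/-- Each member `f n` of a cover of `E` is cut into `f n ∧ ramp h k` and the rest. As `k` grows, the
first parts increase to `f n` on `{h > 1}` and cover the inside; the rests equal `f n` off `{h > 1}`
for every `k` and cover the outside. Additivity of `p` balances the costs. -/
lemma outerContent_inter_add_diff_le (hp : IsPositiveDaniell S p)
    (hS : IsPositiveVectorLattice S) (hStone : IsStonean S) {h : X → ℝ} (hh : h ∈ S)
    (E : Set X) :
    outerContent S p (E ∩ {x | 1 < h x}) + outerContent S p (E \ {x | 1 < h x})
      ≤ outerContent S p E := by
  refine le_iInf₂ fun f hf => ENNReal.le_of_forall_pos_le_add fun ε hε hfin => ?_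
  obtain ⟨δ, hδ, hδε⟩ := ENNReal.exists_pos_sum_of_countable' (ENNReal.coe_pos.2 hε).ne' ℕ
  set v : ℕ → ℕ → X → ℝ := fun n k => f n ⊓ ramp h k with hv
  have hvS : ∀ n k, v n k ∈ S := fun n k => hS.inf_mem _ (hf.1 n) _ (ramp_mem hS hStone hh k)
  have hvm : ∀ n, Monotone (v n) := fun n k l hkl => inf_le_inf_left _ (ramp_mono h hkl)
  have hvf : ∀ n k, v n k ≤ f n := fun n k => inf_le_left
  have hL : ∀ n, ⨆ k, p (v n k) ≠ ∞ := fun n =>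
    ne_top_of_le_ne_top (hp.ne_top _ (hf.1 n))
      (iSup_le fun k => hp.mono hS (hf.1 n) (hvS n k) (hvf n k))
  -- The limit of `v n k` in `k` need not lie in `S` and so cannot be subtracted from `f n`; one
  -- index within `δ n` of the supremum replaces it.
  have hex : ∀ n, ∃ k, ⨆ k, p (v n k) ≤ p (v n k) + δ n := fun n => by
    by_contra! hcon
    have h1 : (⨆ k, p (v n k)) + δ n ≤ ⨆ k, p (v n k) := by
      rw [ENNReal.iSup_add]
      exact iSup_le fun k => (hcon k).le
    exact (ENNReal.lt_add_right (hL n) (hδ n).ne').not_ge h1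
  choose k hk using hex
  have h1 : outerContent S p (E ∩ {x | 1 < h x}) ≤ ∑' n, ⨆ k, p (v n k) := by
    simp only [← fun n => hp.tsum_increment hS (hvS n) (hvm n)]
    refine outerContent_le_tsum_tsum (fun n => increment_mem hS (hvS n) (hvm n)) fun x hx => ?_
    refine (hf.2 x hx.1).trans (ENNReal.tsum_le_tsum fun n => ?_)
    rw [tsum_ofReal_increment hS (hvS n) (hvm n)]
    obtain ⟨l, hl⟩ := (eventually_le_ramp hx.2 (f n x)).exists
    refine le_iSup_of_le l ?_
    simp [hv, hl]
  have h2 : outerContent S p (E \ {x | 1 < h x}) ≤ ∑' n, p (f n - v n (k n)) := by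
    refine outerContent_le_tsum (fun n => hS.sub_mem (hf.1 n) (hvS _ _) (hvf _ _)) fun x hx => ?_
    refine (hf.2 x hx.1).trans (ENNReal.tsum_le_tsum fun n => ?_)
    simp [hv, ramp_eq_zero hx.2, hS.nonneg _ (hf.1 n) x]
  calc _ ≤ ∑' n, ((⨆ k, p (v n k)) + p (f n - v n (k n))) := by
        rw [ENNReal.tsum_add]
        exact add_le_add h1 h2
    _ ≤ ∑' n, (p (f n) + δ n) := ENNReal.tsum_le_tsum fun n => by
        rw [← hp.map_sub_add hS (hf.1 n) (hvS n (k n)) (hvf _ _), add_right_comm]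
        exact add_le_add_left (hk n) _
    _ ≤ _ := by
        rw [ENNReal.tsum_add]
        exact add_le_add_right hδε.le _

lemma generateFrom_levelSystem_le_caratheodory (hp : IsPositiveDaniell S p)
    (hS : IsPositiveVectorLattice S) (hStone : IsStonean S) (h0 : (0 : X → ℝ) ∈ S) :
    MeasurableSpace.generateFrom (levelSystem S) ≤ (hp.outerMeasure h0).caratheodory := by
  have key : ∀ h ∈ S, MeasurableSet[(hp.outerMeasure h0).caratheodory] {x | 1 < h x} :=
    fun h hh => (OuterMeasure.isCaratheodory_iff_le _).2
      (hp.outerContent_inter_add_diff_le hS hStone hh)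
  refine MeasurableSpace.generateFrom_le ?_
  rintro A ⟨f, hf, g, hg, rfl⟩
  exact @MeasurableSet.diff _ (hp.outerMeasure h0).caratheodory _ _ (key f hf) (key g hg)

lemma outerContent_le (hp : IsPositiveDaniell S p) (h0 : (0 : X → ℝ) ∈ S) {g : X → ℝ}
    (hg : g ∈ S) {A : Set X} (h : ∀ x ∈ A, 1 ≤ g x) : outerContent S p A ≤ p g := by
  set u : ℕ → X → ℝ := fun n => if n = 0 then g else 0 with hu
  have hu' : ∀ n, n ≠ 0 → u n = 0 := fun n hn => if_neg hn
  refine (outerContent_le_tsum (f := u) (fun n => ?_) fun x hx => ?_).trans_eq ?_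
  · simp only [hu]; split_ifs; exacts [hg, h0]
  · rw [tsum_eq_single 0 fun n hn => by simp [hu' n hn]]
    simpa [hu] using h x hx
  · rw [tsum_eq_single 0 fun n hn => by rw [hu' n hn, hp.map_zero h0]]
    simp [hu]

lemma le_outerContent (hp : IsPositiveDaniell S p) {g : X → ℝ} (hg : g ∈ S) {A : Set X}
    (h : ∀ x ∈ A, g x ≤ 1) (h' : ∀ x ∉ A, g x ≤ 0) : p g ≤ outerContent S p A := by
  refine le_iInf₂ fun f hf => hp.le_tsum g hg f hf.1 fun x => ?_
  by_cases hx : x ∈ A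
  · exact (ENNReal.ofReal_le_one.2 (h x hx)).trans (hf.2 x hx)
  · simp [ENNReal.ofReal_of_nonpos (h' x hx)]

/-! ### Layer-by-layer comparison of the functional with the integral -/

section Layers

variable [mX : MeasurableSpace X] {P : Measure X}

lemma lintegral_stepCount (hmX : mX = MeasurableSpace.generateFrom (levelSystem S))
    (hS : IsPositiveVectorLattice S) (hStone : IsStonean S) {g : X → ℝ} (hg : g ∈ S) :
    ∫⁻ x, stepCount (g x) ∂P = ∑' j : ℕ, P {x | (j : ℝ) + 1 < g x} := by
  have hm := measurable_of_mem hmX hS hStone hg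
  have hset : ∀ j : ℕ, MeasurableSet {x | (j : ℝ) + 1 < g x} := fun j =>
    measurableSet_lt measurable_const hm
  have heq : ∀ x, stepCount (g x)
      = ∑' j : ℕ, {x | (j : ℝ) + 1 < g x}.indicator (fun _ => (1 : ℝ≥0∞)) x := fun x => by
    simp only [stepCount, Set.indicator_apply, Set.mem_ofPred_eq]
  simp only [heq]
  rw [lintegral_tsum fun j => (measurable_const.indicator (hset j)).aemeasurable]
  simp [lintegral_indicator (hset _)]

/-- The layer of `g` between heights `j` and `j + 1` equals `1` on `{g > j + 1}`, so it dominates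
the outer content of that set. The layers add up to at most `p g`. -/
lemma lintegral_stepCount_le (hp : IsPositiveDaniell S p)
    (hmX : mX = MeasurableSpace.generateFrom (levelSystem S))
    (hS : IsPositiveVectorLattice S) (hStone : IsStonean S)
    (hP : ∀ A ∈ levelSystem S, P A = outerContent S p A) {g : X → ℝ} (hg : g ∈ S) :
    ∫⁻ x, stepCount (g x) ∂P ≤ p g := by
  have hinc := increment_mem hS (truncation_mem hStone hg) (truncation_mono g)
  rw [lintegral_stepCount hmX hS hStone hg]
  calc _ ≤ ∑' n, p (increment (truncation g) n) := ENNReal.tsum_le_tsum fun j => by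
        rw [hP _ (setOf_lt_mem_levelSystem hS hStone hg (by positivity))]
        refine hp.outerContent_le (hS.zero_mem ⟨g, hg⟩) (hinc j) fun x hx => ?_
        simp only [Set.mem_ofPred_eq] at hx
        cases j with
        | zero =>
          simp only [Nat.cast_zero, zero_add] at hx
          simp [increment, truncation, hx.le]
        | succ j =>
          push_cast at hx
          simp only [increment, truncation, Pi.sub_apply, Pi.inf_apply]
          push_cast
          rw [inf_eq_right.2 hx.le, inf_eq_right.2 (by linarith)]
          linarith
    _ = ⨆ n, p (truncation g n) :=
        hp.tsum_increment hS (truncation_mem hStone hg) (truncation_mono g)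
    _ ≤ p g := iSup_le fun n => hp.mono hS hg (truncation_mem hStone hg n) inf_le_left

/-- The next layer, between `j + 1` and `j + 2`, is at most `1` and vanishes off `{g > j + 1}`, so
its value is at most the measure of that set. These layers fill `g - g ∧ 1`. -/
lemma map_sub_inf_one_le (hp : IsPositiveDaniell S p)
    (hmX : mX = MeasurableSpace.generateFrom (levelSystem S))
    (hS : IsPositiveVectorLattice S) (hStone : IsStonean S)
    (hP : ∀ A ∈ levelSystem S, P A = outerContent S p A) {g : X → ℝ} (hg : g ∈ S) :
    p (g - g ⊓ fun _ => 1) ≤ ∫⁻ x, stepCount (g x) ∂P := by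
  have hinc := increment_mem hS (truncation_mem hStone hg) (truncation_mono g)
  rw [lintegral_stepCount hmX hS hStone hg]
  calc _ ≤ ∑' n, p (increment (truncation g) (n + 1)) := by
        refine hp.le_tsum _ (hS.sub_mem hg (hStone g hg 1 zero_le_one) inf_le_left) _
          (fun n => hinc (n + 1)) fun x => ?_
        have h1 : ENNReal.ofReal (g x) ≤ ∑' n, ENNReal.ofReal (increment (truncation g) n x) := by
          rw [tsum_ofReal_increment hS (truncation_mem hStone hg) (truncation_mono g)]
          obtain ⟨n, hn⟩ := exists_nat_ge (g x)
          refine le_iSup_of_le n (ENNReal.ofReal_le_ofReal ?_)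
          simp only [truncation, Pi.inf_apply]
          exact le_min le_rfl (by linarith)
        rw [tsum_eq_zero_add' ENNReal.summable] at h1
        have h2 : increment (truncation g) 0 x = min (g x) 1 := by simp [increment, truncation]
        rw [h2, ← tsub_le_iff_left, ← ENNReal.ofReal_sub _
          (le_min (hS.nonneg g hg x) zero_le_one)] at h1
        exact h1
    _ ≤ _ := ENNReal.tsum_le_tsum fun j => by
        rw [hP _ (setOf_lt_mem_levelSystem hS hStone hg (by positivity))]
        refine hp.le_outerContent (hinc (j + 1)) (fun x hx => ?_) fun x hx => ?_ <;>
        · simp only [Set.mem_ofPred_eq] at hx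
          simp only [increment, truncation, Pi.sub_apply, Pi.inf_apply]
          push_cast
          first
          | rw [inf_eq_right.2 hx.le]
            linarith [min_le_right (g x) ((j : ℝ) + 1 + 1)]
          | rw [inf_eq_left.2 (not_lt.1 hx)]
            linarith [min_le_left (g x) ((j : ℝ) + 1 + 1)]

/-- Applying the two layer estimates to `(n + 1) f` and dividing by `n + 1` compares `f - 1 / (n +
1)` on one side with `f` on the other; both directions follow from monotone convergence, for the
integral and for `p`. -/
lemma lintegral_eq (hp : IsPositiveDaniell S p)
    (hmX : mX = MeasurableSpace.generateFrom (levelSystem S))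
    (hS : IsPositiveVectorLattice S) (hStone : IsStonean S)
    (hP : ∀ A ∈ levelSystem S, P A = outerContent S p A) {f : X → ℝ} (hf : f ∈ S) :
    ∫⁻ x, ENNReal.ofReal (f x) ∂P = p f := by
  have hm := measurable_of_mem hmX hS hStone hf
  have hanti : ∀ {k l : ℕ}, k ≤ l → 1 / ((l : ℝ) + 1) ≤ 1 / ((k : ℝ) + 1) := fun {k l} hkl => by
    have : (k : ℝ) ≤ l := by exact_mod_cast hkl
    gcongr
  have hlim : ∀ c : ℝ, Tendsto (fun n : ℕ => ENNReal.ofReal (c - 1 / ((n : ℝ) + 1))) atTop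
      (𝓝 (ENNReal.ofReal c)) := fun c => by
    refine (ENNReal.continuous_ofReal.tendsto c).comp ?_
    simpa using (tendsto_const_nhds (x := c)).sub
      (tendsto_one_div_add_atTop_nhds_zero_nat (𝕜 := ℝ))
  have hsup : ∀ x, ENNReal.ofReal (f x) = ⨆ n : ℕ, ENNReal.ofReal (f x - 1 / ((n : ℝ) + 1)) :=
    fun x => (iSup_eq_of_tendsto
      (fun k l hkl => ENNReal.ofReal_le_ofReal (sub_le_sub_left (hanti hkl) _)) (hlim (f x))).symm
  have hcast : ∀ n : ℕ, ((n + 1 : ℕ) : ℝ≥0∞) ≠ 0 := fun n => by simp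
  have hscale : ∀ (n : ℕ) (h : X → ℝ), Measurable h →
      ∫⁻ x, ENNReal.ofReal (((n + 1) • h) x) ∂P
        = ((n + 1 : ℕ) : ℝ≥0∞) * ∫⁻ x, ENNReal.ofReal (h x) ∂P := fun n h hh => by
    rw [← lintegral_const_mul _ hh.ennreal_ofReal]
    refine lintegral_congr fun x => ?_
    rw [Pi.smul_apply, nsmul_eq_mul, ENNReal.ofReal_mul (by positivity), ENNReal.ofReal_natCast]
  refine le_antisymm ?_ ?_
  · simp only [hsup]
    rw [lintegral_iSup (fun n => (hm.sub_const _).ennreal_ofReal)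
      (fun k l hkl x => ENNReal.ofReal_le_ofReal (sub_le_sub_left (hanti hkl) _))]
    refine iSup_le fun n => ?_
    rw [← ENNReal.mul_le_mul_iff_right (hcast n) (ENNReal.natCast_ne_top _),
      ← hscale n _ (hm.sub_const _), ← hp.map_nsmul hS hf]
    refine le_trans (lintegral_mono fun x => ?_)
      (hp.lintegral_stepCount_le hmX hS hStone hP (hS.nsmul_mem hf (n + 1)))
    refine le_trans (ENNReal.ofReal_le_ofReal (le_of_eq ?_)) (ofReal_sub_one_le_stepCount _)
    simp only [Pi.smul_apply, nsmul_eq_mul]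
    push_cast
    field_simp
  · have hmem : ∀ n : ℕ, f - f ⊓ (fun _ => 1 / ((n : ℝ) + 1)) ∈ S := fun n =>
      hS.sub_mem hf (hStone f hf _ (by positivity)) inf_le_left
    refine (hp.le_iSup hS hf hmem (fun k l hkl => ?_) fun x => ?_).trans (iSup_le fun n => ?_)
    · exact sub_le_sub_left (inf_le_inf_left _ fun x => hanti hkl) _
    · rw [hsup]
      refine iSup_mono fun n => ENNReal.ofReal_le_ofReal ?_
      exact sub_le_sub_left (min_le_right _ _) _
    · rw [← ENNReal.mul_le_mul_iff_right (hcast n) (ENNReal.natCast_ne_top _),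
        ← hscale n _ hm, ← hp.map_nsmul hS (hmem n)]
      have heq : (n + 1) • (f - f ⊓ (fun _ => 1 / ((n : ℝ) + 1)))
          = (n + 1) • f - ((n + 1) • f) ⊓ fun _ => 1 := by
        ext x
        simp only [Pi.smul_apply, Pi.sub_apply, Pi.inf_apply, nsmul_eq_mul]
        push_cast
        rw [mul_sub, mul_min_of_nonneg _ _ (by positivity : (0 : ℝ) ≤ n + 1)]
        congr 2
        field_simp
      rw [heq]
      refine (hp.map_sub_inf_one_le hmX hS hStone hP (hS.nsmul_mem hf (n + 1))).trans ?_
      exact lintegral_mono fun x => stepCount_le_ofReal _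

end Layers

/-- Representation of positive Daniell functionals by measures. -/
theorem exists_measure [mX : MeasurableSpace X] (hp : IsPositiveDaniell S p)
    (hmX : mX = MeasurableSpace.generateFrom (levelSystem S))
    (hS : IsPositiveVectorLattice S) (hStone : IsStonean S) (hne : S.Nonempty) :
    ∃ P : Measure X, ∀ f ∈ S, ∫⁻ x, ENNReal.ofReal (f x) ∂P = p f := by
  have h0 := hS.zero_mem hne
  have hle := hp.generateFrom_levelSystem_le_caratheodory hS hStone h0
  rw [← hmX] at hle
  refine ⟨(hp.outerMeasure h0).toMeasure hle, fun f hf => ?_⟩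
  refine hp.lintegral_eq hmX hS hStone (fun A hA => ?_) hf
  refine toMeasure_apply _ hle ?_
  rw [hmX]
  exact MeasurableSpace.measurableSet_generateFrom hA

end IsPositiveDaniell

end Representation

/-! ### Countable additivity of the variations and their extension to measures -/

section Variation

variable {X : Type*} {𝔖 : Set (Set X)} {ν : 𝔖 → ℝ}

lemma isDecomposition_self (A : 𝔖) : IsDecomposition (A : Set X) (fun _ : Unit => A) :=
  ⟨fun i j h => (h (Subsingleton.elim i j)).elim, Set.iUnion_const _⟩

lemma negVar_eq_posVar_neg (ν : 𝔖 → ℝ) : negVar ν = posVar fun A => -ν A := rfl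

lemma posVar_eq_negVar_neg (ν : 𝔖 → ℝ) : posVar ν = negVar fun A => -ν A := by
  simp [negVar_eq_posVar_neg]

lemma IsMeasure.neg (hν : IsMeasure ν) : IsMeasure fun A => -ν A :=
  fun Λ _ A B hB => (hν Λ A B hB).neg

lemma tsum_le_posVar {Λ : Type} [hΛ : Countable Λ] {A : 𝔖} {B : Λ → 𝔖}
    (hB : IsDecomposition (A : Set X) B) : ∑' i, ENNReal.ofReal (ν (B i)) ≤ posVar ν A :=
  le_sSup ⟨Λ, hΛ, B, hB, rfl⟩

lemma IsDecomposition.sigma {Λ : Type} {A : Set X} {B : Λ → 𝔖} (hB : IsDecomposition A B)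
    {Γ : Λ → Type} {C : ∀ i, Γ i → 𝔖} (hC : ∀ i, IsDecomposition (B i : Set X) (C i)) :
    IsDecomposition A (fun k : Σ i, Γ i => C k.1 k.2) := by
  refine ⟨?_, ?_⟩
  · rintro ⟨i, k⟩ ⟨j, l⟩ h
    by_cases hij : i = j
    · subst hij
      exact (hC i).1 k l fun hkl => h (by rw [hkl])
    · refine (hB.1 i j hij).mono ?_ ?_
      · rw [← (hC i).2]; exact Set.subset_iUnion (fun k => (C i k : Set X)) k
      · rw [← (hC j).2]; exact Set.subset_iUnion (fun k => (C j k : Set X)) l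
  · rw [Set.iUnion_sigma, ← hB.2]
    exact Set.iUnion_congr fun i => (hC i).2

/-- Decompositions of the `B i` glue to one of `A`. Since variations may be infinite, near-optimal
choices are taken along sequences converging to the suprema, not up to an `ε`. -/
lemma tsum_posVar_le {Λ : Type} [Countable Λ] {A : 𝔖} {B : Λ → 𝔖}
    (hB : IsDecomposition (A : Set X) B) : ∑' i, posVar ν (B i) ≤ posVar ν A := by
  have hex : ∀ i, ∃ u : ℕ → ℝ≥0∞, Monotone u ∧ Tendsto u atTop (𝓝 (posVar ν (B i))) ∧
      ∀ n, ∃ (Γ : Type) (_ : Countable Γ) (C : Γ → 𝔖), IsDecomposition (B i : Set X) C ∧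
        u n = ∑' k, ENNReal.ofReal (ν (C k)) := fun i =>
    exists_seq_tendsto_sSup ⟨_, Unit, inferInstance, fun _ => B i, isDecomposition_self _, rfl⟩
      (OrderTop.bddAbove _)
  choose u _ hlim Γ hΓ C hC hu using hex
  rw [ENNReal.tsum_eq_iSup_sum]
  refine iSup_le fun F => le_of_tendsto' (tendsto_finsetSum F fun i _ => hlim i) fun n => ?_
  refine (ENNReal.sum_le_tsum F).trans ?_
  simp only [hu]
  rw [← ENNReal.tsum_sigma' fun k : Σ i, Γ i n => ENNReal.ofReal (ν (C k.1 n k.2))]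
  exact tsum_le_posVar (hB.sigma fun i => hC i n)

/-- A decomposition `C` of `A` is refined by the sets `C k ∩ B i`. Refining does not decrease the
sum of positive parts, and regrouping by `i` gives decompositions of the `B i`. -/
lemma posVar_le_tsum (hν : IsMeasure ν) (hinter : ∀ A ∈ 𝔖, ∀ B ∈ 𝔖, A ∩ B ∈ 𝔖) {Λ : Type}
    [Countable Λ] {A : 𝔖} {B : Λ → 𝔖} (hB : IsDecomposition (A : Set X) B) :
    posVar ν A ≤ ∑' i, posVar ν (B i) := by
  refine sSup_le ?_
  rintro v ⟨Γ, _, C, hC, rfl⟩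
  set D : Γ → Λ → 𝔖 := fun k i => ⟨C k ∩ B i, hinter _ (C k).2 _ (B i).2⟩
  have h1 : ∀ k, IsDecomposition (C k : Set X) (D k) := fun k => by
    refine ⟨fun i j h => (hB.1 i j h).mono Set.inter_subset_right Set.inter_subset_right, ?_⟩
    have : (C k : Set X) ⊆ A := hC.2 ▸ Set.subset_iUnion (fun k => (C k : Set X)) k
    simp only [D]
    rw [← Set.inter_iUnion, hB.2, Set.inter_eq_left.2 this]
  have h2 : ∀ i, IsDecomposition (B i : Set X) (fun k => D k i) := fun i => by
    refine ⟨fun k l h => (hC.1 k l h).mono Set.inter_subset_left Set.inter_subset_left, ?_⟩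
    have : (B i : Set X) ⊆ A := hB.2 ▸ Set.subset_iUnion (fun k => (B k : Set X)) i
    simp only [D]
    rw [← Set.iUnion_inter, hC.2, Set.inter_eq_right.2 this]
  calc ∑' k, ENNReal.ofReal (ν (C k)) ≤ ∑' (k) (i), ENNReal.ofReal (ν (D k i)) :=
        ENNReal.tsum_le_tsum fun k => ofReal_le_tsum_ofReal (hν Λ (C k) (D k) (h1 k))
    _ = ∑' (i) (k), ENNReal.ofReal (ν (D k i)) := ENNReal.tsum_comm
    _ ≤ _ := ENNReal.tsum_le_tsum fun i => tsum_le_posVar (h2 i)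

lemma posVar_eq_tsum (hν : IsMeasure ν) (hinter : ∀ A ∈ 𝔖, ∀ B ∈ 𝔖, A ∩ B ∈ 𝔖) {ι : Type*}
    [Countable ι] {A : 𝔖} {B : ι → 𝔖}
    (hd : ∀ i j, i ≠ j → Disjoint (B i : Set X) (B j : Set X)) (hU : ⋃ i, (B i : Set X) = A) :
    posVar ν A = ∑' i, posVar ν (B i) := by
  -- Decompositions are indexed by types in `Type`, so an index from another universe is replaced by
  -- a subset of `ℕ`.
  obtain ⟨e, he⟩ := exists_injective_nat ι
  let E := Equiv.ofInjective e he
  have hB : IsDecomposition (A : Set X) (fun k : Set.range e => B (E.symm k)) :=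
    ⟨fun k l h => hd _ _ (E.symm.injective.ne h), by
      rw [← hU]
      exact E.symm.surjective.iUnion_comp fun i => (B i : Set X)⟩
  rw [← E.symm.tsum_eq]
  exact le_antisymm (posVar_le_tsum hν hinter hB) (tsum_posVar_le hB)

lemma tsum_ofReal_add_ofReal_neg {ι : Type*} {f : ι → ℝ} {a : ℝ} (h : HasSum f a) :
    ∑' i, ENNReal.ofReal (f i) + ENNReal.ofReal (-a)
      = ∑' i, ENNReal.ofReal (-f i) + ENNReal.ofReal a := by
  have key : ∀ g : ι → ℝ, Summable g → Summable (fun i => max (g i) 0) ∧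
      ∑' i, ENNReal.ofReal (g i) = ENNReal.ofReal (∑' i, max (g i) 0) := fun g hg => by
    have hs : Summable fun i => max (g i) 0 :=
      hg.abs.of_nonneg_of_le (fun i => le_max_right _ _)
        fun i => max_le (le_abs_self _) (abs_nonneg _)
    refine ⟨hs, ?_⟩
    rw [ENNReal.ofReal_tsum_of_nonneg (fun i => le_max_right _ _) hs]
    congr 1 with i
    rcases le_total (g i) 0 with h | h
    · simp [h, ENNReal.ofReal_of_nonpos h]
    · simp [h]
  obtain ⟨hs, he⟩ := key f h.summable
  obtain ⟨hs', he'⟩ := key (fun i => -f i) h.summable.neg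
  have hdiff : ∑' i, max (f i) 0 - ∑' i, max (-f i) 0 = a := by
    rw [← hs.tsum_sub hs', ← h.tsum_eq]
    congr 1 with i
    rcases le_total (f i) 0 with h | h
    · rw [max_eq_right h, max_eq_left (by linarith)]; ring
    · rw [max_eq_left h, max_eq_right (by linarith)]; ring
  have h0 : 0 ≤ ∑' i, max (f i) 0 := tsum_nonneg fun i => le_max_right _ _
  have h0' : 0 ≤ ∑' i, max (-f i) 0 := tsum_nonneg fun i => le_max_right _ _
  rw [he, he']
  rcases le_total a 0 with ha | ha
  · rw [ENNReal.ofReal_of_nonpos ha, ← ENNReal.ofReal_add h0 (by linarith), add_zero]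
    congr 1
    linarith
  · rw [ENNReal.ofReal_of_nonpos (by linarith : -a ≤ 0), ← ENNReal.ofReal_add h0' ha, add_zero]
    congr 1
    linarith

/-- In every decomposition of `A` the sums of positive and negative parts differ by `ν A`. The form
without subtraction survives the supremum even when a variation is infinite. -/
lemma posVar_add_ofReal_neg_le (hν : IsMeasure ν) (A : 𝔖) :
    posVar ν A + ENNReal.ofReal (-ν A) ≤ negVar ν A + ENNReal.ofReal (ν A) := by
  rw [posVar, ENNReal.sSup_add]
  · refine iSup₂_le ?_
    rintro _ ⟨Λ, _, B, hB, rfl⟩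
    rw [tsum_ofReal_add_ofReal_neg (hν Λ A B hB)]
    exact add_le_add_left (tsum_le_posVar (ν := fun A => -ν A) hB) _
  · exact ⟨_, Unit, inferInstance, _, isDecomposition_self A, rfl⟩

lemma toReal_posVar_sub_toReal_negVar (hν : IsMeasure ν) {A : 𝔖} (hp : posVar ν A ≠ ∞)
    (hn : negVar ν A ≠ ∞) : (posVar ν A).toReal - (negVar ν A).toReal = ν A := by
  have h1 := posVar_add_ofReal_neg_le hν A
  have h2 := posVar_add_ofReal_neg_le hν.neg A
  rw [← negVar_eq_posVar_neg, ← posVar_eq_negVar_neg, neg_neg] at h2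
  have h := congrArg ENNReal.toReal (le_antisymm h1 h2)
  rw [ENNReal.toReal_add hp ENNReal.ofReal_ne_top, ENNReal.toReal_add hn ENNReal.ofReal_ne_top,
    ENNReal.toReal_ofReal', ENNReal.toReal_ofReal'] at h
  rcases le_total (ν A) 0 with h3 | h3
  · rw [max_eq_left (by linarith), max_eq_right h3] at h; linarith
  · rw [max_eq_right (by linarith), max_eq_left h3] at h; linarith

open Classical in
/-- The positive variation as an additive content. -/
noncomputable def posVarContent (hν : IsMeasure ν) (h𝔖 : IsSetSemiring 𝔖) :
    AddContent ℝ≥0∞ 𝔖 where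
  toFun s := if h : s ∈ 𝔖 then posVar ν ⟨s, h⟩ else 0
  empty' := by
    -- The empty set is decomposed by the empty family, so its variation is an empty sum.
    rw [dif_pos h𝔖.empty_mem, posVar_eq_tsum hν h𝔖.inter_mem (ι := Empty) (B := Empty.elim)
      (fun i => i.elim) (by simp)]
    simp
  sUnion' I hI hd hU := by
    rw [dif_pos hU, posVar_eq_tsum hν h𝔖.inter_mem (ι := I) (B := fun s => ⟨s, hI s.2⟩)
      (fun s t hst => hd s.2 t.2 fun h => hst (Subtype.ext h)) (by
        simp [Set.sUnion_eq_iUnion]), tsum_fintype, ← Finset.sum_coe_sort I]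
    refine Finset.sum_congr rfl fun s _ => ?_
    rw [dif_pos (hI s.2)]

lemma posVarContent_apply (hν : IsMeasure ν) (h𝔖 : IsSetSemiring 𝔖) {s : Set X} (hs : s ∈ 𝔖) :
    posVarContent hν h𝔖 s = posVar ν ⟨s, hs⟩ := dif_pos hs

/-- The sets `f i` may overlap. Each `f i` minus its predecessors is a finite disjoint union of
members `J i`; all these pieces together decompose the union, and those in `J i` have total
variation at most that of `f i`. -/
lemma isSigmaSubadditive_posVarContent (hν : IsMeasure ν) (h𝔖 : IsSetSemiring 𝔖) :
    (posVarContent hν h𝔖).IsSigmaSubadditive := by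
  classical
  intro f hf hU
  have hI : ∀ i, (((Finset.range i).image f : Finset (Set X)) : Set (Set X)) ⊆ 𝔖 := fun i s hs => by
    obtain ⟨j, _, rfl⟩ := Finset.mem_image.1 (Finset.mem_coe.1 hs)
    exact hf j
  choose J hJ hJd hJU using fun i => h𝔖.exists_disjoint_finset_sdiff_eq (hf i) (hI i)
  have hsub : ∀ i, ∀ s ∈ J i, s ⊆ f i \ ⋃ j < i, f j := fun i s hs => by
    have h := Set.subset_sUnion_of_mem (Finset.mem_coe.2 hs)
    rw [← hJU i] at h
    simpa using h
  have hdisj : ∀ k l : Σ i, J i, k ≠ l → Disjoint (k.2 : Set X) (l.2 : Set X) := by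
    have hlt : ∀ i j, i < j → ∀ s ∈ J i, ∀ t ∈ J j, Disjoint s t := fun i j hij s hs t ht => by
      rw [Set.disjoint_left]
      intro x hxs hxt
      exact (hsub j t ht hxt).2
        (Set.mem_biUnion (show i ∈ {i | i < j} from hij) (hsub i s hs hxs).1)
    rintro ⟨i, s⟩ ⟨j, t⟩ h
    rcases lt_trichotomy i j with hij | rfl | hij
    · exact hlt i j hij s s.2 t t.2
    · exact hJd i s.2 t.2 fun hst => h (by rw [Subtype.ext hst])
    · exact (hlt j i hij t t.2 s s.2).symm
  have hunion : ⋃ k : Σ i, J i, (k.2 : Set X) = ⋃ i, f i := by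
    refine Set.Subset.antisymm ?_ fun x hx => ?_
    · exact Set.iUnion_subset fun k =>
        ((hsub _ _ k.2.2).trans Set.sdiff_subset).trans (Set.subset_iUnion f k.1)
    · have hex := Set.mem_iUnion.1 hx
      have h1 : x ∈ f (Nat.find hex) \ ⋃₀
          ((Finset.range (Nat.find hex)).image f : Finset (Set X)) := by
        refine ⟨Nat.find_spec hex, ?_⟩
        rintro ⟨s, hs, hxs⟩
        obtain ⟨j, hj, rfl⟩ := Finset.mem_image.1 (Finset.mem_coe.1 hs)
        exact Nat.find_min hex (Finset.mem_range.1 hj) hxs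
      rw [hJU] at h1
      obtain ⟨s, hs, hxs⟩ := h1
      exact Set.mem_iUnion.2 ⟨⟨_, s, hs⟩, hxs⟩
  rw [posVarContent_apply hν h𝔖 hU, posVar_eq_tsum hν h𝔖.inter_mem (ι := Σ i, J i)
    (B := fun k => ⟨k.2, hJ _ k.2.2⟩) hdisj hunion, ENNReal.tsum_sigma']
  refine ENNReal.tsum_le_tsum fun i => ?_
  refine le_trans (le_of_eq ?_) (sum_addContent_le_of_subset (m := posVarContent hν h𝔖) h𝔖 (hJ i)
    (hJd i) (hf i) fun s hs => (hsub i s hs).trans Set.sdiff_subset)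
  rw [tsum_fintype, ← Finset.sum_coe_sort (J i)]
  exact Finset.sum_congr rfl fun s _ => (posVarContent_apply hν h𝔖 (hJ i s.2)).symm

lemma exists_measure_eq_posVar [mX : MeasurableSpace X]
    (hmX : mX = MeasurableSpace.generateFrom 𝔖) (hν : IsMeasure ν) (h𝔖 : IsSetSemiring 𝔖) :
    ∃ N : Measure X, ∀ A : 𝔖, N A = posVar ν A :=
  ⟨(posVarContent hν h𝔖).measure h𝔖 hmX.le (isSigmaSubadditive_posVarContent hν h𝔖), fun A => by
    rw [AddContent.measure_eq _ h𝔖 hmX _ A.2, posVarContent_apply hν h𝔖 A.2]⟩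

end Variation

/-! ### The Lebesgue-Riesz integral in terms of the extended variations -/

section Integral

variable {X : Type*} {𝔖 : Set (Set X)} {ν : 𝔖 → ℝ} [mX : MeasurableSpace X]

lemma measurableSet_of_mem (hmX : mX = MeasurableSpace.generateFrom 𝔖) (A : 𝔖) :
    MeasurableSet (A : Set X) := by
  rw [hmX]
  exact MeasurableSpace.measurableSet_generateFrom A.2

namespace FormalSum

lemma measurable_posValue (hmX : mX = MeasurableSpace.generateFrom 𝔖) (C : FormalSum 𝔖) :
    Measurable C.posValue := by
  have := C.countable_index
  exact Measurable.tsum fun i => measurable_const.indicator (measurableSet_of_mem hmX _)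

lemma lintegral_posValue (hmX : mX = MeasurableSpace.generateFrom 𝔖) (C : FormalSum 𝔖)
    (N : Measure X) :
    ∫⁻ x, C.posValue x ∂N = ∑' i, ENNReal.ofReal (C.coeff i) * N (C.coeffSet i) := by
  have := C.countable_index
  simp only [posValue]
  rw [lintegral_tsum fun i =>
    (measurable_const.indicator (measurableSet_of_mem hmX _)).aemeasurable]
  simp [lintegral_indicator (measurableSet_of_mem hmX _)]

/-- The formal sum with the opposite coefficients. -/
def neg (C : FormalSum 𝔖) : FormalSum 𝔖 := { C with coeff := fun i => -C.coeff i }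

lemma measurable_negValue (hmX : mX = MeasurableSpace.generateFrom 𝔖) (C : FormalSum 𝔖) :
    Measurable C.negValue := C.neg.measurable_posValue hmX

lemma lintegral_negValue (hmX : mX = MeasurableSpace.generateFrom 𝔖) (C : FormalSum 𝔖)
    (N : Measure X) :
    ∫⁻ x, C.negValue x ∂N = ∑' i, ENNReal.ofReal (-C.coeff i) * N (C.coeffSet i) :=
  C.neg.lintegral_posValue hmX N

/-- Finiteness of the integral of `posValue` makes the set of indefinite points `∞ - ∞` null, so `f`
is almost everywhere a difference of two integrable functions. -/
lemma integrable_and_integral_eq (hmX : mX = MeasurableSpace.generateFrom 𝔖) (C : FormalSum 𝔖)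
    {N : Measure X} {f : X → ℝ}
    (hC : ∀ x, (C.posValue x = ∞ ∧ C.negValue x = ∞) ∨
      IsFiniteDiff (C.posValue x) (C.negValue x) (f x))
    (hp : ∫⁻ x, C.posValue x ∂N ≠ ∞) (hn : ∫⁻ x, C.negValue x ∂N ≠ ∞) :
    Integrable f N ∧
      ∫ x, f x ∂N = (∫⁻ x, C.posValue x ∂N).toReal - (∫⁻ x, C.negValue x ∂N).toReal := by
  have hpm := C.measurable_posValue hmX
  have hnm := C.measurable_negValue hmX
  have hpf := ae_lt_top hpm hp
  have hnf := ae_lt_top hnm hn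
  have hae : (fun x => (C.posValue x).toReal - (C.negValue x).toReal) =ᵐ[N] f := by
    filter_upwards [hpf] with x hx
    rcases hC x with h | h
    · exact (hx.ne h.1).elim
    · exact h.2.2
  have hpi := integrable_toReal_of_lintegral_ne_top hpm.aemeasurable hp
  have hni := integrable_toReal_of_lintegral_ne_top hnm.aemeasurable hn
  refine ⟨(hpi.sub hni).congr hae, ?_⟩
  rw [← integral_congr_ae hae, integral_sub hpi hni, integral_toReal hpm.aemeasurable hpf,
    integral_toReal hnm.aemeasurable hnf]

end FormalSum

/-- `posIntegral` pairs positive coefficients with `N` and negative ones with `N'`, and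
`negIntegral` does the opposite. Their finiteness is that of all four integrals, which then regroup
by measure. -/
lemma HasIntegral.integral_sub_integral (hmX : mX = MeasurableSpace.generateFrom 𝔖)
    {N N' : Measure X} (hN : ∀ A : 𝔖, N A = posVar ν A) (hN' : ∀ A : 𝔖, N' A = negVar ν A)
    {f : X → ℝ} {a : ℝ} (h : HasIntegral ν f a) :
    Integrable f N ∧ Integrable f N' ∧ ∫ x, f x ∂N - ∫ x, f x ∂N' = a := by
  obtain ⟨C, hC, hp, hn, ha⟩ := h
  have hpos : C.posIntegral ν = ∫⁻ x, C.posValue x ∂N + ∫⁻ x, C.negValue x ∂N' := by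
    rw [C.lintegral_posValue hmX, C.lintegral_negValue hmX, ← ENNReal.tsum_add]
    simp only [hN, hN']
    rfl
  have hneg : C.negIntegral ν = ∫⁻ x, C.negValue x ∂N + ∫⁻ x, C.posValue x ∂N' := by
    rw [C.lintegral_posValue hmX, C.lintegral_negValue hmX, ← ENNReal.tsum_add]
    simp only [hN, hN']
    rfl
  rw [hpos] at hp ha
  rw [hneg] at hn ha
  rw [ENNReal.add_ne_top] at hp hn
  obtain ⟨h1, h2⟩ := C.integrable_and_integral_eq hmX hC hp.1 hn.1
  obtain ⟨h3, h4⟩ := C.integrable_and_integral_eq hmX hC hn.2 hp.2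
  refine ⟨h1, h3, ?_⟩
  rw [ENNReal.toReal_add hp.1 hp.2, ENNReal.toReal_add hn.1 hn.2] at ha
  linarith

end Integral

/-! ### Differences of two measures on a set system -/

section Difference

variable {X : Type*} {𝔖 : Set (Set X)} [mX : MeasurableSpace X]

/-- The difference of two measures on a set system. -/
noncomputable def measureDiff (𝔖 : Set (Set X)) (P Q : Measure X) (A : 𝔖) : ℝ :=
  (P A).toReal - (Q A).toReal

variable {P Q : Measure X}

lemma IsDecomposition.measure_eq (hmX : mX = MeasurableSpace.generateFrom 𝔖) {Λ : Type}
    [Countable Λ] {A : Set X} {B : Λ → 𝔖} (hB : IsDecomposition A B) (P : Measure X) :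
    P A = ∑' i, P (B i) := by
  rw [← hB.2, measure_iUnion (fun i j h => hB.1 i j h) fun i => measurableSet_of_mem hmX _]

lemma isMeasure_measureDiff (hmX : mX = MeasurableSpace.generateFrom 𝔖)
    (hP : ∀ A : 𝔖, P A ≠ ∞) (hQ : ∀ A : 𝔖, Q A ≠ ∞) : IsMeasure (measureDiff 𝔖 P Q) := by
  intro Λ _ A B hB
  have key : ∀ R : Measure X, (∀ A : 𝔖, R A ≠ ∞) →
      HasSum (fun i => (R (B i)).toReal) (R A).toReal := fun R hR => by
    have h := hB.measure_eq hmX R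
    rw [h, ENNReal.tsum_toReal_eq fun i => hR _]
    exact ENNReal.hasSum_toReal (h ▸ hR A)
  exact (key P hP).sub (key Q hQ)

/-- Only an inequality is available in general, since `P` and `Q` may share mass that cancels in the
difference. -/
lemma posVar_measureDiff_le (hmX : mX = MeasurableSpace.generateFrom 𝔖) (P Q : Measure X)
    (A : 𝔖) : posVar (measureDiff 𝔖 P Q) A ≤ P A := by
  refine sSup_le ?_
  rintro _ ⟨Λ, _, B, hB, rfl⟩
  rw [hB.measure_eq hmX P]
  refine ENNReal.tsum_le_tsum fun i => ?_
  exact (ENNReal.ofReal_le_ofReal (sub_le_self _ ENNReal.toReal_nonneg)).trans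
    ENNReal.ofReal_toReal_le

lemma negVar_measureDiff_le (hmX : mX = MeasurableSpace.generateFrom 𝔖) (P Q : Measure X)
    (A : 𝔖) : negVar (measureDiff 𝔖 P Q) A ≤ Q A := by
  have h : (fun A => -measureDiff 𝔖 P Q A) = measureDiff 𝔖 Q P := by
    ext A
    simp [measureDiff]
  rw [negVar_eq_posVar_neg, h]
  exact posVar_measureDiff_le hmX Q P A

/-- The mass lost in passing from `P` and `Q` to the variations is the same on both sides, so
differences of integrals may be computed with `P` and `Q`. -/
lemma posVar_add_eq_negVar_add (hmX : mX = MeasurableSpace.generateFrom 𝔖)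
    (hP : ∀ A : 𝔖, P A ≠ ∞) (hQ : ∀ A : 𝔖, Q A ≠ ∞) (A : 𝔖) :
    posVar (measureDiff 𝔖 P Q) A + Q A = negVar (measureDiff 𝔖 P Q) A + P A := by
  have hp := ne_top_of_le_ne_top (hP A) (posVar_measureDiff_le hmX P Q A)
  have hn := ne_top_of_le_ne_top (hQ A) (negVar_measureDiff_le hmX P Q A)
  have h := toReal_posVar_sub_toReal_negVar (isMeasure_measureDiff hmX hP hQ) hp hn
  rw [← ENNReal.toReal_eq_toReal_iff' (ENNReal.add_ne_top.2 ⟨hp, hQ A⟩)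
    (ENNReal.add_ne_top.2 ⟨hn, hP A⟩), ENNReal.toReal_add hp (hQ A), ENNReal.toReal_add hn (hP A)]
  simp only [measureDiff] at h ⊢
  linarith

lemma isLocallyFiniteSemivariation_measureDiff (hmX : mX = MeasurableSpace.generateFrom 𝔖)
    (hP : ∀ A : 𝔖, P A ≠ ∞) (hQ : ∀ A : 𝔖, Q A ≠ ∞) :
    IsLocallyFiniteSemivariation (measureDiff 𝔖 P Q) := by
  intro A
  refine Bornology.IsBounded.closure
    ((Metric.isBounded_closedBall (x := (0 : ℝ)) (r := (P A).toReal + (Q A).toReal)).subset ?_)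
  rintro _ ⟨J, _, B, hd, hsub, rfl⟩
  have key : ∀ R : Measure X, (∀ A : 𝔖, R A ≠ ∞) →
      0 ≤ ∑ j, (R (B j)).toReal ∧ ∑ j, (R (B j)).toReal ≤ (R A).toReal := fun R hR => by
    refine ⟨Finset.sum_nonneg fun _ _ => ENNReal.toReal_nonneg, ?_⟩
    rw [← ENNReal.toReal_sum fun j _ => hR (B j), ← tsum_fintype (L := .unconditional J),
      ← measure_iUnion (fun i j h => hd i j h) fun i => measurableSet_of_mem hmX _]
    exact ENNReal.toReal_mono (hR A) (measure_mono (Set.iUnion_subset hsub))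
  obtain ⟨h1, h2⟩ := key P hP
  obtain ⟨h3, h4⟩ := key Q hQ
  rw [mem_closedBall_zero_iff, Real.norm_eq_abs]
  simp only [measureDiff, Finset.sum_sub_distrib]
  rw [abs_le]
  constructor <;> linarith

/-- Formal sums with nonnegative coefficients integrate their value. -/
lemma hasIntegral_measureDiff (hmX : mX = MeasurableSpace.generateFrom 𝔖)
    (hP : ∀ A : 𝔖, P A ≠ ∞) (hQ : ∀ A : 𝔖, Q A ≠ ∞) {f : X → ℝ} (hf : ∀ x, 0 ≤ f x)
    (hPf : ∫⁻ x, ENNReal.ofReal (f x) ∂P ≠ ∞) (hQf : ∫⁻ x, ENNReal.ofReal (f x) ∂Q ≠ ∞)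
    (C : FormalSum 𝔖) (hC : ∀ i, 0 ≤ C.coeff i)
    (hCf : ∀ x, C.posValue x = ENNReal.ofReal (f x)) :
    HasIntegral (measureDiff 𝔖 P Q) f
      ((∫⁻ x, ENNReal.ofReal (f x) ∂P).toReal - (∫⁻ x, ENNReal.ofReal (f x) ∂Q).toReal) := by
  have hneg : ∀ i, ENNReal.ofReal (-C.coeff i) = 0 := fun i =>
    ENNReal.ofReal_of_nonpos (neg_nonpos.2 (hC i))
  refine ⟨C, fun x => Or.inr ⟨by simp [hCf], by simp [FormalSum.negValue, hneg], ?_⟩, ?_⟩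
  · simp [hCf, FormalSum.negValue, hneg, hf x]
  · have hint : ∀ N : Measure X, ∫⁻ x, ENNReal.ofReal (f x) ∂N
        = ∑' i, ENNReal.ofReal (C.coeff i) * N (C.coeffSet i) := fun N => by
      simp only [← hCf]
      exact C.lintegral_posValue hmX N
    have hp : C.posIntegral (measureDiff 𝔖 P Q) ≤ ∫⁻ x, ENNReal.ofReal (f x) ∂P := by
      rw [hint]
      refine ENNReal.tsum_le_tsum fun i => ?_
      rw [hneg, zero_mul, add_zero]
      exact mul_le_mul_right (posVar_measureDiff_le hmX P Q _) _
    have hn : C.negIntegral (measureDiff 𝔖 P Q) ≤ ∫⁻ x, ENNReal.ofReal (f x) ∂Q := by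
      rw [hint]
      refine ENNReal.tsum_le_tsum fun i => ?_
      rw [hneg, zero_mul, zero_add]
      exact mul_le_mul_right (negVar_measureDiff_le hmX P Q _) _
    have hp' := ne_top_of_le_ne_top hPf hp
    have hn' := ne_top_of_le_ne_top hQf hn
    have heq : C.posIntegral (measureDiff 𝔖 P Q) + ∫⁻ x, ENNReal.ofReal (f x) ∂Q
        = C.negIntegral (measureDiff 𝔖 P Q) + ∫⁻ x, ENNReal.ofReal (f x) ∂P := by
      rw [hint, hint, FormalSum.posIntegral, FormalSum.negIntegral, ← ENNReal.tsum_add,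
        ← ENNReal.tsum_add]
      congr 1 with i
      rw [hneg, zero_mul, zero_mul, add_zero, zero_add, ← mul_add, ← mul_add,
        posVar_add_eq_negVar_add hmX hP hQ]
    refine ⟨hp', hn', ?_⟩
    have h := congrArg ENNReal.toReal heq
    rw [ENNReal.toReal_add hp' hQf, ENNReal.toReal_add hn' hPf] at h
    linarith

end Difference

/-! ### Binary expansion of a function into level sets -/

section Dyadic

/-- The sum of the indicators of `2j + 1 < t ≤ 2j + 2`. -/
noncomputable def lastDigit (t : ℝ) : ℝ≥0∞ :=
  ∑' j : ℕ, if 2 * (j : ℝ) + 1 < t ∧ ¬ 2 * (j : ℝ) + 2 < t then 1 else 0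

/-- Splitting the count for `2 t` by parity, each odd index `2 j + 1` records `j + 1 < t`. The even
index `2 j` records the same, or else the case `2 j + 1 < 2 t ≤ 2 j + 2`, which is the new binary
digit. -/
lemma stepCount_two_mul (t : ℝ) : stepCount (2 * t) = lastDigit (2 * t) + 2 * stepCount t := by
  have h1 : ∀ j : ℕ, (if ((2 * j + 1 : ℕ) : ℝ) + 1 < 2 * t then 1 else 0 : ℝ≥0∞)
      = if (j : ℝ) + 1 < t then 1 else 0 := fun j => by
    refine if_congr ?_ rfl rfl
    push_cast
    constructor <;> intro h <;> linarith
  have h2 : ∀ j : ℕ, (if ((2 * j : ℕ) : ℝ) + 1 < 2 * t then 1 else 0 : ℝ≥0∞)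
      = (if 2 * (j : ℝ) + 1 < 2 * t ∧ ¬ 2 * (j : ℝ) + 2 < 2 * t then 1 else 0)
        + if (j : ℝ) + 1 < t then 1 else 0 := fun j => by
    push_cast
    by_cases h : (j : ℝ) + 1 < t
    · have h' : 2 * (j : ℝ) + 2 < 2 * t := by linarith
      rw [if_pos h, if_pos (by linarith), if_neg (fun h'' => h''.2 h'), zero_add]
    · have h' : ¬ 2 * (j : ℝ) + 2 < 2 * t := fun h'' => h (by linarith)
      simp only [h, h', if_false, not_false_eq_true, and_true, add_zero]
  rw [stepCount, ← tsum_even_add_odd ENNReal.summable ENNReal.summable]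
  simp only [h1, h2]
  rw [ENNReal.tsum_add, add_assoc, ← two_mul]
  rfl

lemma stepCount_add_sum_lastDigit (t : ℝ) (K : ℕ) :
    stepCount t + ∑ n ∈ Finset.range K, ENNReal.ofReal ((1 / 2) ^ (n + 1)) *
      lastDigit (2 ^ (n + 1) * t) = ENNReal.ofReal ((1 / 2) ^ K) * stepCount (2 ^ K * t) := by
  induction K with
  | zero => simp
  | succ K ih =>
    rw [Finset.sum_range_succ, ← add_assoc, ih, pow_succ (2 : ℝ) K, mul_comm (2 ^ K) (2 : ℝ),
      mul_assoc, stepCount_two_mul, mul_add, add_comm]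
    congr 1
    rw [← mul_assoc]
    congr 1
    rw [← ENNReal.ofReal_ofNat 2, ← ENNReal.ofReal_mul (by positivity)]
    congr 1
    rw [pow_succ]
    ring

/-- The partial sums telescope to `2 ^ (-K)` times the step count of `2 ^ K t`, which for `t ≥ 0` is
within `2 ^ (-K)` of `t`; for `t ≤ 0` everything vanishes. -/
lemma stepCount_add_tsum_lastDigit (t : ℝ) :
    stepCount t + ∑' n : ℕ, ENNReal.ofReal ((1 / 2) ^ (n + 1)) * lastDigit (2 ^ (n + 1) * t)
      = ENNReal.ofReal t := by
  have h1 := (ENNReal.tendsto_nat_tsum fun n : ℕ =>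
    ENNReal.ofReal ((1 / 2) ^ (n + 1)) * lastDigit (2 ^ (n + 1) * t)).const_add (stepCount t)
  simp only [stepCount_add_sum_lastDigit] at h1
  refine tendsto_nhds_unique h1 ?_
  have hpow : ∀ K : ℕ, ((1 : ℝ) / 2) ^ K * 2 ^ K = 1 := fun K => by
    rw [← mul_pow]; norm_num
  have hlim : Tendsto (fun K : ℕ => ENNReal.ofReal (t - (1 / 2) ^ K)) atTop
      (𝓝 (ENNReal.ofReal t)) := by
    refine (ENNReal.continuous_ofReal.tendsto t).comp ?_
    simpa using (tendsto_const_nhds (x := t)).sub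
      (tendsto_pow_atTop_nhds_zero_of_lt_one (r := (1 / 2 : ℝ)) (by norm_num) (by norm_num))
  refine tendsto_of_tendsto_of_tendsto_of_le_of_le hlim tendsto_const_nhds (fun K => ?_)
    fun K => ?_
  · refine le_trans (le_of_eq ?_) (mul_le_mul_right (ofReal_sub_one_le_stepCount _) _)
    rw [← ENNReal.ofReal_mul (by positivity), mul_sub, ← mul_assoc, hpow, one_mul, mul_one]
  · refine (mul_le_mul_right (stepCount_le_ofReal _) _).trans_eq ?_
    rw [← ENNReal.ofReal_mul (by positivity), ← mul_assoc, hpow, one_mul]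

variable {X : Type*} {S : Set (X → ℝ)}

/-- The dyadic representation of a member of `S` as a formal sum of level sets. -/
noncomputable def dyadicSum (hS : IsPositiveVectorLattice S) (hStone : IsStonean S) {f : X → ℝ}
    (hf : f ∈ S) : FormalSum (levelSystem S) where
  Index := ℕ ⊕ ℕ × ℕ
  countable_index := inferInstance
  coeff := Sum.elim (fun _ => 1) fun k => (1 / 2) ^ (k.1 + 1)
  coeffSet := Sum.elim
    (fun j => ⟨{x | (j : ℝ) + 1 < f x}, setOf_lt_mem_levelSystem hS hStone hf (by positivity)⟩)
    fun k => ⟨{x | (2 * (k.2 : ℝ) + 1) / 2 ^ (k.1 + 1) < f x} \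
        {x | (2 * (k.2 : ℝ) + 2) / 2 ^ (k.1 + 1) < f x},
      setOf_lt_diff_mem_levelSystem hS hStone hf (by positivity) (by positivity)⟩

lemma dyadicSum_coeff_nonneg (hS : IsPositiveVectorLattice S) (hStone : IsStonean S) {f : X → ℝ}
    (hf : f ∈ S) (i) : 0 ≤ (dyadicSum hS hStone hf).coeff i := by
  rcases i with i | i
  · exact zero_le_one
  · exact pow_nonneg (by norm_num) _

lemma dyadicSum_posValue (hS : IsPositiveVectorLattice S) (hStone : IsStonean S) {f : X → ℝ}
    (hf : f ∈ S) (x : X) : (dyadicSum hS hStone hf).posValue x = ENNReal.ofReal (f x) := by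
  rw [← stepCount_add_tsum_lastDigit]
  change ∑' i : ℕ ⊕ ℕ × ℕ, _ = _
  rw [Summable.tsum_sum ENNReal.summable ENNReal.summable, ENNReal.tsum_prod']
  congr 1
  · refine tsum_congr fun j => ?_
    simp [dyadicSum, Set.indicator_apply]
  · refine tsum_congr fun n => ?_
    rw [lastDigit, ← ENNReal.tsum_mul_left]
    refine tsum_congr fun j => ?_
    simp only [dyadicSum, Sum.elim_inr, Set.indicator_apply, Set.mem_sdiff, Set.mem_ofPred_eq,
      div_lt_iff₀' (by positivity : (0 : ℝ) < 2 ^ (n + 1)), mul_ite, mul_one, mul_zero]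

end Dyadic

/-! ### Uniqueness, existence and conclusion -/

section Main

variable {X : Type*} {S : Set (X → ℝ)}

lemma ramp_inf_one_le (hS : IsPositiveVectorLattice S) {h : X → ℝ} (hh : h ∈ S) (k : ℕ) (x : X) :
    (ramp h k ⊓ fun _ => 1) x ≤ h x := by
  by_cases hx : 1 < h x
  · exact (min_le_right _ _).trans hx.le
  · refine (min_le_left _ _).trans ?_
    rw [ramp_eq_zero hx]
    exact hS.nonneg h hh x

lemma tendsto_ramp_inf_one (h : X → ℝ) (x : X) :
    Tendsto (fun k => (ramp h k ⊓ fun _ => 1) x) atTop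
      (𝓝 ({x | 1 < h x}.indicator (fun _ => (1 : ℝ)) x)) := by
  by_cases hx : 1 < h x
  · rw [Set.indicator_of_mem (show x ∈ {x | 1 < h x} from hx)]
    refine tendsto_const_nhds.congr' ?_
    filter_upwards [eventually_le_ramp hx 1] with k hk
    exact (min_eq_right hk).symm
  · rw [Set.indicator_of_notMem (show x ∉ {x | 1 < h x} from hx)]
    simp [ramp_eq_zero hx]

/-- Dominated convergence with majorant `h`: the truncated ramps are at most `1 < h` on `{h > 1}`
and vanish elsewhere. -/
lemma tendsto_integral_ramp [mX : MeasurableSpace X]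
    (hmX : mX = MeasurableSpace.generateFrom (levelSystem S)) (hS : IsPositiveVectorLattice S)
    (hStone : IsStonean S) {h : X → ℝ} (hh : h ∈ S) {N : Measure X} (hN : Integrable h N) :
    Tendsto (fun k => ∫ x, (ramp h k ⊓ fun _ => 1) x ∂N) atTop
      (𝓝 (N {x | 1 < h x}).toReal) := by
  have hmem : ∀ k, ramp h k ⊓ (fun _ => 1) ∈ S := fun k =>
    hStone _ (ramp_mem hS hStone hh k) 1 zero_le_one
  have hset : MeasurableSet {x | 1 < h x} :=
    measurableSet_lt measurable_const (measurable_of_mem hmX hS hStone hh)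
  have hlim := tendsto_integral_of_dominated_convergence (μ := N) h
    (fun k => (measurable_of_mem hmX hS hStone (hmem k)).aestronglyMeasurable) hN
    (fun k => ae_of_all _ fun x => by
      rw [Real.norm_of_nonneg (hS.nonneg _ (hmem k) x)]
      exact ramp_inf_one_le hS hh k x)
    (ae_of_all _ fun x => tendsto_ramp_inf_one h x)
  rwa [integral_indicator_const _ hset, smul_eq_mul, mul_one] at hlim

/-- A representing measure is determined on superlevel sets by the functional. -/
lemma tendsto_apply_ramp {m : S → ℝ} {ν : levelSystem S → ℝ} (hS : IsPositiveVectorLattice S)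
    (hStone : IsStonean S) (hν : IsMeasure ν) (hm : ∀ f : S, HasIntegral ν f (m f)) {h : X → ℝ}
    (hh : h ∈ S) :
    Tendsto (fun k => m ⟨ramp h k ⊓ fun _ => 1,
      hStone _ (ramp_mem hS hStone hh k) 1 zero_le_one⟩) atTop
      (𝓝 (ν ⟨{x | 1 < h x}, setOf_one_lt_mem_levelSystem hS hh⟩)) := by
  let mX : MeasurableSpace X := MeasurableSpace.generateFrom (levelSystem S)
  have hC := isSetSemiring_levelSystem hS ⟨h, hh⟩
  obtain ⟨N, hN⟩ := exists_measure_eq_posVar rfl hν hC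
  obtain ⟨N', hN'⟩ := exists_measure_eq_posVar rfl hν.neg hC
  have key := fun f : S => (hm f).integral_sub_integral rfl hN hN'
  obtain ⟨h1, h2, -⟩ := key ⟨h, hh⟩
  have hlim := (tendsto_integral_ramp rfl hS hStone hh h1).sub
    (tendsto_integral_ramp rfl hS hStone hh h2)
  set A : levelSystem S := ⟨{x | 1 < h x}, setOf_one_lt_mem_levelSystem hS hh⟩
  -- The variations of `ν` are not assumed finite. Integrability of `h` makes them finite on `{h >
  -- 1}`, and only then can they be subtracted to recover `ν`.
  have hfin : N A ≠ ∞ := (Integrable.measure_gt_lt_top h1 zero_lt_one).ne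
  have hfin' : N' A ≠ ∞ := (Integrable.measure_gt_lt_top h2 zero_lt_one).ne
  have hA : (N A).toReal - (N' A).toReal = ν A := by
    rw [hN] at hfin ⊢
    rw [hN'] at hfin' ⊢
    exact toReal_posVar_sub_toReal_negVar hν hfin hfin'
  rw [← hA]
  exact hlim.congr fun k => (key ⟨_, hStone _ (ramp_mem hS hStone hh k) 1 zero_le_one⟩).2.2

/-- `{f > 1}` is the disjoint union of `{f > 1} \ {g > 1}` and `{f ∧ g > 1}`, so values on plain
superlevel sets determine `ν`. -/
lemma IsMeasure.apply_diff {ν : levelSystem S → ℝ} (hν : IsMeasure ν)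
    (hS : IsPositiveVectorLattice S) {f g : X → ℝ} (hf : f ∈ S) (hg : g ∈ S) :
    ν ⟨_, diff_mem_levelSystem hf hg⟩ = ν ⟨_, setOf_one_lt_mem_levelSystem hS hf⟩
      - ν ⟨_, setOf_one_lt_mem_levelSystem hS (hS.inf_mem _ hf _ hg)⟩ := by
  have h := hν Bool ⟨_, setOf_one_lt_mem_levelSystem hS hf⟩
    (fun b => bif b then ⟨_, diff_mem_levelSystem hf hg⟩
      else ⟨_, setOf_one_lt_mem_levelSystem hS (hS.inf_mem _ hf _ hg)⟩) ?_
  · have h' := (hasSum_fintype _).unique h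
    simp only [Fintype.sum_bool, cond_true, cond_false] at h'
    linarith
  · have hd : Disjoint ({x | 1 < f x} \ {x | 1 < g x}) {x | 1 < (f ⊓ g) x} := by
      rw [Set.disjoint_left]
      intro x hx hx'
      have h1 : 1 < (f ⊓ g) x := hx'
      have h2 : 1 < g x := h1.trans_le (min_le_right _ _)
      exact hx.2 h2
    refine ⟨?_, ?_⟩
    · rintro (_ | _) (_ | _) hij
      exacts [(hij rfl).elim, hd.symm, hd, (hij rfl).elim]
    · ext x
      simp only [Set.mem_iUnion, Bool.exists_bool, cond_true, cond_false, Set.mem_sdiff,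
        Set.mem_ofPred_eq, Pi.inf_apply, lt_inf_iff]
      tauto

lemma eq_of_hasIntegral {m : S → ℝ} {μ ν : levelSystem S → ℝ} (hS : IsPositiveVectorLattice S)
    (hStone : IsStonean S) (hμ : IsMeasure μ) (hμm : ∀ f : S, HasIntegral μ f (m f))
    (hν : IsMeasure ν) (hνm : ∀ f : S, HasIntegral ν f (m f)) : ν = μ := by
  have key : ∀ h (hh : h ∈ S), ν ⟨_, setOf_one_lt_mem_levelSystem hS hh⟩
      = μ ⟨_, setOf_one_lt_mem_levelSystem hS hh⟩ := fun h hh =>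
    tendsto_nhds_unique (tendsto_apply_ramp hS hStone hν hνm hh)
      (tendsto_apply_ramp hS hStone hμ hμm hh)
  ext ⟨A, f, hf, g, hg, rfl⟩
  rw [hν.apply_diff hS hf hg, hμ.apply_diff hS hf hg, key f hf,
    key _ (hS.inf_mem f hf g hg)]

lemma exists_isMeasure_hasIntegral {m : S → ℝ} (hS : IsPositiveVectorLattice S)
    (hStone : IsStonean S) (hm : IsDaniell m) (hbv : IsLocallyBoundedVariation m) :
    ∃ μ : levelSystem S → ℝ, IsMeasure μ ∧ IsLocallyFiniteSemivariation μ ∧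
      ∀ f : S, HasIntegral μ f (m f) := by
  -- If `S` is empty there are no level sets and every claim is vacuous; otherwise `0 ∈ S`.
  rcases S.eq_empty_or_nonempty with hE | hne
  · have : IsEmpty (levelSystem S) := ⟨fun ⟨A, f, hf, _⟩ => by simp [hE] at hf⟩
    exact ⟨isEmptyElim, fun _ _ A => isEmptyElim A, fun A => isEmptyElim A,
      fun f => by have := f.2; simp [hE] at this⟩
  let mX : MeasurableSpace X := MeasurableSpace.generateFrom (levelSystem S)
  have hp := isPositiveDaniell_posPart hS hm hbv
  have hq := isPositiveDaniell_posPart hS hm.neg hbv.neg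
  obtain ⟨P, hP⟩ := hp.exists_measure rfl hS hStone hne
  obtain ⟨Q, hQ⟩ := hq.exists_measure rfl hS hStone hne
  have hfin : ∀ {p : (X → ℝ) → ℝ≥0∞} {N : Measure X}, IsPositiveDaniell S p →
      (∀ f ∈ S, ∫⁻ x, ENNReal.ofReal (f x) ∂N = p f) → ∀ A : levelSystem S, N A ≠ ∞ := by
    rintro p N hp hN ⟨A, f, hf, g, hg, rfl⟩
    -- Markov's inequality: `A` lies in `{f ≥ 1}`, so its measure is at most `p f`.
    refine ne_top_of_le_ne_top (hp.ne_top f hf) ?_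
    rw [← hN f hf, ← one_mul (N _)]
    refine le_trans (mul_le_mul_right (measure_mono fun x hx => ?_) _) (mul_meas_ge_le_lintegral
      (measurable_of_mem rfl hS hStone hf).ennreal_ofReal 1)
    exact ENNReal.one_le_ofReal.2 (le_of_lt hx.1)
  have hPfin := hfin hp hP
  have hQfin := hfin hq hQ
  refine ⟨measureDiff _ P Q, isMeasure_measureDiff rfl hPfin hQfin,
    isLocallyFiniteSemivariation_measureDiff rfl hPfin hQfin, fun f => ?_⟩
  rw [← toReal_posPart_sub_toReal_posPart_neg hS hm hbv f, ← hP f f.2, ← hQ f f.2]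
  exact hasIntegral_measureDiff rfl hPfin hQfin (hS.nonneg f f.2)
    (by rw [hP f f.2]; exact hp.ne_top f f.2) (by rw [hQ f f.2]; exact hq.ne_top f f.2)
    (dyadicSum hS hStone f.2) (dyadicSum_coeff_nonneg hS hStone f.2)
    (dyadicSum_posValue hS hStone f.2)

end Main

end LebesgueRiesz

theorem mainTheorem12 {X : Type*} (S : Set (X → ℝ))
    (hS : LebesgueRiesz.IsPositiveVectorLattice S) (hStone : LebesgueRiesz.IsStonean S)
    (m : S → ℝ) (hm : LebesgueRiesz.IsDaniell m)
    (hbv : LebesgueRiesz.IsLocallyBoundedVariation m) :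
    LebesgueRiesz.IsIntervalSystem (LebesgueRiesz.levelSystem S) ∧
    ∃ μ : LebesgueRiesz.levelSystem S → ℝ,
      (LebesgueRiesz.IsMeasure μ ∧ LebesgueRiesz.IsLocallyFiniteSemivariation μ ∧
        ∀ f : S, LebesgueRiesz.HasIntegral μ (f : X → ℝ) (m f)) ∧
      ∀ ν : LebesgueRiesz.levelSystem S → ℝ,
        LebesgueRiesz.IsMeasure ν →
        (∀ f : S, LebesgueRiesz.HasIntegral ν (f : X → ℝ) (m f)) → ν = μ := by
  obtain ⟨μ, hμ, hfin, hint⟩ := LebesgueRiesz.exists_isMeasure_hasIntegral hS hStone hm hbv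
  exact ⟨LebesgueRiesz.isIntervalSystem_levelSystem hS, μ, ⟨hμ, hfin, hint⟩, fun ν hν hνm =>
    LebesgueRiesz.eq_of_hasIntegral hS hStone hμ hint hν hνm⟩
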